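/- Let $(m_k)_{k\ge 1}$ be a sequence of integers $m_1<m_2<\cdots$ that is lacunary with ratio $q$: for some real $q>1$, $m_{k+1}/m_k\ge q$ for all $k\ge 1$. Let $(a_{k,n})_{1\le k\le n}$ be a triangular array of real numbers, and put $$S^{\mathrm T}_n(x)=\sum_{k=1}^n a_{k,n}\cos(2\pi m_k x)\quad(0\le x\le 1),\qquad A_n=\Big(\tfrac12\sum_{k=1}^n a_{k,n}^2\Big)^{1/2},\qquad d_n=\max_{1\le k\le n}|a_{k,n}|.$$ Suppose that $A_n\to\infty$ as $n\to\infty$ and that there is $\varepsilon>0$ such that, as $n\to\infty$, $$n^{1+\varepsilon}d_n^3\to 0\ \text{ if } 1<q\le 2,\qquad n^{1+\varepsilon}d_n^4\to 0\ \text{ if } q>2.$$ Then, for every bounded Jordan measurable set $B\subset\mathbb R$ (that is, every bounded set whose boundary has Lebesgue measure zero), $$A_n\,\big|\{x\in[0,1] : S^{\mathrm T}_n(x)\in B\}\big|\longrightarrow \frac{1}{\sqrt{2\pi}}\,|B|\qquad (n\to\infty),$$ where $|\cdot|$ denotes Lebesgue measure. -/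

import Mathlib

open Filter Topology MeasureTheory

namespace LacunaryTrig

/-- An infinite sequence of integers `m 1 < m 2 < ⋯` with `m (k + 1) / m k ≥ q > 1` for all `k ≥ 1`.
The value `m 0` plays no role.  All `m k` with `k ≥ 1` are then positive
(see `IsLacunary.pos`). -/
structure IsLacunary (m : ℕ → ℤ) (q : ℝ) : Prop where
  one_lt : 1 < q
  lt_succ : ∀ k : ℕ, 1 ≤ k → m k < m (k + 1)
  ratio : ∀ k : ℕ, 1 ≤ k → q ≤ (m (k + 1) : ℝ) / (m k : ℝ)

theorem IsLacunary.pos {m : ℕ → ℤ} {q : ℝ} (h : IsLacunary m q) (k : ℕ) (hk : 1 ≤ k) :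
    0 < m k := by
  have h1 := h.one_lt
  have h2 : (m k : ℝ) < (m (k + 1) : ℝ) := by exact_mod_cast h.lt_succ k hk
  have h3 := h.ratio k hk
  by_contra hneg
  have h4 : (m k : ℝ) ≤ 0 := by exact_mod_cast not_lt.mp hneg
  rcases h4.lt_or_eq with h5 | h5
  · rw [le_div_iff_of_neg h5] at h3
    nlinarith
  · rw [h5, div_zero] at h3
    linarith

/-- The partial sum `S_n(x) = ∑_{k=1}^n a_{k,n} cos (2 π m_k x)`; the entry `a_{k,n}` of the
triangular array is `a k n`, and only the entries with `1 ≤ k ≤ n` are used. -/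
noncomputable def partialSum (a : ℕ → ℕ → ℝ) (m : ℕ → ℤ) (n : ℕ) (x : ℝ) : ℝ :=
  ∑ k ∈ Finset.Icc 1 n, a k n * Real.cos (2 * Real.pi * (m k : ℝ) * x)

/-- `A_n = (½ ∑_{k=1}^n a_{k,n}²)^{1/2}`. -/
noncomputable def normA (a : ℕ → ℕ → ℝ) (n : ℕ) : ℝ :=
  Real.sqrt ((1 / 2 : ℝ) * ∑ k ∈ Finset.Icc 1 n, a k n ^ 2)

/-- `d_n = max_{1 ≤ k ≤ n} |a_{k,n}|` (and `0` for `n = 0`). -/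
noncomputable def maxCoeff (a : ℕ → ℕ → ℝ) (n : ℕ) : ℝ :=
  (((Finset.Icc 1 n).sup fun k => ‖a k n‖₊ : NNReal) : ℝ)

/-- Bounded Jordan measurable subsets of the line: bounded, with Lebesgue-null boundary. -/
def IsBoundedJordanMeasurable (B : Set ℝ) : Prop :=
  Bornology.IsBounded B ∧ volume (frontier B) = 0

end LacunaryTrig

/-!
The theorem follows from a precise estimate of the characteristic function `φ_n(t)` of `S_n`,
uniform for `t` in a compact interval, combined with weighting by a kernel whose Fourier transform
has compact support.

Replace each factor of `e^{itS_n} = ∏ e^{i t a_k cos(2π m_k x)}` by its Taylor polynomial of degree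
four. The remainders contribute `O(n d_n^5)` in total, which is `o(1 / A_n)` because
`A_n ≤ √n d_n` and `n d_n^4 → 0`. The means of the Taylor polynomials multiply to
`e^{-t²A_n²/2} (1 + o(1))`. The mean of the product of the normalised polynomials is a sum over the
integer relations `∑ J_k m_k = 0` with `|J_k| ≤ 4`, each of weight at most `δ ^ (∑ |J_k|)` with
`δ = T d_n`, and the trivial relation contributes `1`. The counting bound `exists_relWeight_le`
shows that the nontrivial relations contribute at most `(1 + C δ^r)^n - 1`, where `r = 3` in
general and `r = 4` if `q > 2`. Its reason is that, reading a relation from the largest index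
down, a term can be placed freely only when the partial sum collected so far is negligible, and
such a free term must be followed by at least `r - 1` further ones, counted with multiplicity,
whose positions are determined up to boundedly many choices before the partial sum is negligible
again. Hence
`φ_n(t) = e^{-t²A_n²/2} (1 + o(1)) + o(1 / A_n)`, which is `exists_sumCharFun_approx`.

For the passage to the law of `S_n`, both this law and the Gaussian law of variance `A_n²` are
weighted by the Fejér kernel and multiplied by `A_n`. Their Fourier transforms have the same limit
(`norm_integral_fejer_sub_le`), namely that of the weighted Lebesgue measure divided by `√(2π)`
(`tendsto_integral_gaussian`). Lévy's continuity theorem gives weak convergence of the weighted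
measures, hence convergence for continuous test functions of compact support, and the indicator
function of a bounded Jordan measurable set is squeezed between such functions
(`tendsto_mul_measure_of_jordan`).
-/

namespace LacunaryTrig

/-! ### Weighted counts of integer relations -/

/-- The weighted number of relations `v + ∑_{i=1}^k J_i m_i = 0` with integers `|J_i| ≤ 4`, where a
relation has weight `δ ^ (∑ |J_i|)`. It is defined by recursion on the largest index, the sum over
`j` running over the possible values of the top coefficient. -/
noncomputable def relWeight (m : ℕ → ℤ) (δ : ℝ) : ℕ → ℤ → ℝ
  | 0, v => if v = 0 then 1 else 0
  | k + 1, v => ∑ j ∈ Finset.Icc (-4 : ℤ) 4, δ ^ j.natAbs * relWeight m δ k (v + j * m (k + 1))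

theorem relWeight_nonneg (m : ℕ → ℤ) {δ : ℝ} (hδ : 0 ≤ δ) (k : ℕ) (v : ℤ) :
    0 ≤ relWeight m δ k v := by
  induction k generalizing v with
  | zero => rw [relWeight]; split_ifs <;> norm_num
  | succ k ih =>
    rw [relWeight]
    exact Finset.sum_nonneg fun j _ => mul_nonneg (by positivity) (ih _)

theorem relWeight_succ (m : ℕ → ℤ) (δ : ℝ) (k : ℕ) (v : ℤ) :
    relWeight m δ (k + 1) v = relWeight m δ k v +
      ∑ j ∈ (Finset.Icc (-4 : ℤ) 4).erase 0,
        δ ^ j.natAbs * relWeight m δ k (v + j * m (k + 1)) := by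
  rw [relWeight, ← Finset.add_sum_erase _ _ (by simp : (0 : ℤ) ∈ Finset.Icc (-4 : ℤ) 4)]
  simp

/-- The real sequence `m k`, continued by `m 1 / q` at the unused index `k = 0`, so that every term
is positive and every ratio of consecutive terms is at least `q`. -/
noncomputable def scale (m : ℕ → ℤ) (q : ℝ) (k : ℕ) : ℝ :=
  if k = 0 then (m 1 : ℝ) / q else (m k : ℝ)

theorem scale_succ (m : ℕ → ℤ) (q : ℝ) (k : ℕ) : scale m q (k + 1) = m (k + 1) := by
  simp [scale]

theorem IsLacunary.scale_pos {m : ℕ → ℤ} {q : ℝ} (h : IsLacunary m q) (k : ℕ) :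
    0 < scale m q k := by
  have hq : 0 < q := zero_lt_one.trans h.one_lt
  rcases k with _ | k
  · have : (0 : ℝ) < m 1 := by exact_mod_cast h.pos 1 le_rfl
    simpa [scale] using div_pos this hq
  · rw [scale_succ]; exact_mod_cast h.pos (k + 1) (by omega)

theorem IsLacunary.mul_scale_le {m : ℕ → ℤ} {q : ℝ} (h : IsLacunary m q) (k : ℕ) :
    q * scale m q k ≤ scale m q (k + 1) := by
  have hq : 0 < q := zero_lt_one.trans h.one_lt
  rcases k with _ | k
  · simp only [scale, if_true, zero_add, one_ne_zero, if_false]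
    rw [mul_div_cancel₀ _ hq.ne']
  · have h1 := h.ratio (k + 1) (by omega)
    have h2 : (0 : ℝ) < m (k + 1) := by exact_mod_cast h.pos (k + 1) (by omega)
    rw [scale_succ, scale_succ]
    rwa [le_div_iff₀ h2] at h1

theorem natAbs_bounds_of_mem {j : ℤ} (hj : j ∈ (Finset.Icc (-4 : ℤ) 4).erase 0) :
    j.natAbs ≤ 4 ∧ 1 ≤ j.natAbs := by
  simp only [Finset.mem_erase, Finset.mem_Icc] at hj
  omega

theorem abs_cast_add_mul_ge (v j n : ℤ) (hn : (0 : ℝ) < n) :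
    |(v : ℝ)| - j.natAbs * (n : ℝ) ≤ |((v + j * n : ℤ) : ℝ)| := by
  have h1 : |(j : ℝ) * n| = j.natAbs * (n : ℝ) := by
    rw [abs_mul, abs_of_pos hn, Nat.cast_natAbs, Int.cast_abs]
  have := abs_sub_abs_le_abs_sub (v : ℝ) (-(j * n : ℝ))
  rw [abs_neg, h1, sub_neg_eq_add] at this
  push_cast
  exact this

/-- There is no relation when `|v|` exceeds `4 * ∑_{i ≤ k} m_i`, which is at most
`4 * q / (q - 1) * m_k`. -/
theorem IsLacunary.relWeight_eq_zero {m : ℕ → ℤ} {q : ℝ} (h : IsLacunary m q) (δ : ℝ) (k : ℕ)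
    (v : ℤ) (hv : 4 * q / (q - 1) * scale m q k < |(v : ℝ)|) : relWeight m δ k v = 0 := by
  have hq := h.one_lt
  have hM : 0 < 4 * q / (q - 1) := div_pos (by linarith) (by linarith)
  induction k generalizing v with
  | zero =>
    have h0 := mul_pos hM (h.scale_pos 0)
    have : v ≠ 0 := by
      rintro rfl
      simp at hv
      linarith
    simp [relWeight, this]
  | succ k ih =>
    rw [relWeight]
    refine Finset.sum_eq_zero fun j hj => ?_
    rw [ih, mul_zero]
    have hm : (0 : ℝ) < m (k + 1) := by exact_mod_cast h.pos (k + 1) (by omega)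
    have h1 := abs_cast_add_mul_ge v j (m (k + 1)) hm
    have hj4 : (j.natAbs : ℝ) ≤ 4 := by
      have : j.natAbs ≤ 4 := by simp only [Finset.mem_Icc] at hj; omega
      exact_mod_cast this
    have h2 := h.mul_scale_le k
    rw [scale_succ] at hv h2
    have h3 : 4 * q / (q - 1) - 4 = (4 * q / (q - 1)) / q := by
      have : q - 1 ≠ 0 := by linarith
      have : q ≠ 0 := by linarith
      field_simp
      ring
    have h4 : (4 * q / (q - 1)) * scale m q k ≤ (4 * q / (q - 1)) / q * m (k + 1) := by
      rw [div_mul_eq_mul_div _ q, le_div_iff₀ (by linarith)]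
      nlinarith
    rw [← h3] at h4
    nlinarith

/-- If `|v| ≥ (κ + s - 1) m_k`, then fewer than `s` further terms leave a remainder of size at
least `κ` times the current scale, so that every relation uses at least `s` terms. Since a remainder
of that size must be reduced within boundedly many levels, each of these terms costs a factor `δ`
and only a bounded number of choices. The hypothesis on `U` absorbs what happens afterwards. -/
theorem IsLacunary.relWeight_far {m : ℕ → ℤ} {q κ : ℝ} (h : IsLacunary m q) (hκ : 0 < κ)
    (hκ1 : κ ≤ 1) (S : ℕ) :
    ∃ K : ℝ, 1 ≤ K ∧ ∀ (δ U : ℝ) (k : ℕ), 0 ≤ δ → δ ≤ 1 →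
      (∀ i ≤ k, ∀ v, relWeight m δ i v ≤ U) → ∀ s ≤ S, ∀ i ≤ k, ∀ v : ℤ,
      (κ + s - 1) * scale m q i ≤ |(v : ℝ)| → relWeight m δ i v ≤ K * δ ^ s * U := by
  have hq := h.one_lt
  have hM : 0 < 4 * q / (q - 1) := div_pos (by linarith) (by linarith)
  induction S with
  | zero =>
    refine ⟨1, le_rfl, fun δ U k _ _ hU s hs i hi v _ => ?_⟩
    obtain rfl : s = 0 := by omega
    simpa using hU i hi v
  | succ S ih =>
    obtain ⟨K, hK1, hK⟩ := ih
    set M := 4 * q / (q - 1) with hMdef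
    set B := 8 * K * M * (q / (q - 1)) with hB
    have hq1 : 0 < q / (q - 1) := div_pos (by linarith) (by linarith)
    have hB0 : 0 ≤ B := by positivity
    refine ⟨max K (B / κ), hK1.trans (le_max_left _ _), fun δ U k hδ hδ1 hU s hs i hi v hv => ?_⟩
    have hU0 : 0 ≤ U := (relWeight_nonneg m hδ 0 0).trans (hU 0 (Nat.zero_le _) 0)
    rcases Nat.lt_or_ge S s with hs' | hs'
    swap
    · refine (hK δ U k hδ hδ1 hU s hs' i hi v hv).trans ?_
      gcongr
      exact le_max_left _ _
    obtain rfl : s = S + 1 := by omega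
    have hS : (0 : ℝ) ≤ S := by positivity
    have hc : 0 < κ + (S + 1 : ℕ) - 1 := by push_cast; linarith
    -- the factor `scale m q i / |v|` makes the bound contract when a level is skipped
    have key : ∀ i ≤ k, ∀ v : ℤ, (κ + (S + 1 : ℕ) - 1) * scale m q i ≤ |(v : ℝ)| →
        relWeight m δ i v ≤ B * δ ^ (S + 1) * U * (scale m q i / |(v : ℝ)|) := by
      intro i
      induction i with
      | zero =>
        intro _ v hv
        have h0 : 0 < |(v : ℝ)| := lt_of_lt_of_le (mul_pos hc (h.scale_pos 0)) hv
        have : v ≠ 0 := by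
          rintro rfl
          simp at h0
        rw [relWeight, if_neg this]
        have := (h.scale_pos 0).le
        positivity
      | succ i ihi =>
        intro hi v hv
        have hμ := h.scale_pos i
        have hμ' := h.scale_pos (i + 1)
        have hqμ := h.mul_scale_le i
        have hv0 : 0 < |(v : ℝ)| := lt_of_lt_of_le (mul_pos hc hμ') hv
        rcases lt_or_ge (M * scale m q (i + 1)) |(v : ℝ)| with hbig | hsmall
        · rw [h.relWeight_eq_zero δ (i + 1) v hbig]
          positivity
        have hμle : scale m q i ≤ scale m q (i + 1) := by nlinarith
        have h1 : relWeight m δ i v ≤ B * δ ^ (S + 1) * U * (scale m q i / |(v : ℝ)|) := by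
          refine ihi (by omega) v (le_trans ?_ hv)
          gcongr
        have h2 : ∀ j ∈ (Finset.Icc (-4 : ℤ) 4).erase 0,
            δ ^ j.natAbs * relWeight m δ i (v + j * m (i + 1)) ≤ K * δ ^ (S + 1) * U := by
          intro j hj
          obtain ⟨hj4, hj1⟩ := natAbs_bounds_of_mem hj
          have hm : (0 : ℝ) < m (i + 1) := by rwa [scale_succ] at hμ'
          have h3 := abs_cast_add_mul_ge v j (m (i + 1)) hm
          have h4 := hK δ U k hδ hδ1 hU (S + 1 - j.natAbs) (by omega) i (by omega)
            (v + j * m (i + 1)) ?_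
          · calc _ ≤ δ ^ j.natAbs * (K * δ ^ (S + 1 - j.natAbs) * U) := by gcongr
              _ = K * δ ^ (j.natAbs + (S + 1 - j.natAbs)) * U := by rw [pow_add]; ring
              _ ≤ _ := by
                gcongr ?_ * ?_ * _
                exact pow_le_pow_of_le_one hδ hδ1 (by omega)
          · rcases Nat.lt_or_ge j.natAbs (S + 1) with hjS | hjS
            · rw [Nat.cast_sub hjS.le]
              rw [scale_succ] at hv hμle
              refine le_trans ?_ h3
              have hj' : (j.natAbs : ℝ) ≤ S := by exact_mod_cast Nat.lt_succ_iff.mp hjS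
              have hc' : 0 ≤ κ + ((S + 1 : ℕ) - j.natAbs : ℝ) - 1 := by push_cast; linarith
              nlinarith [mul_le_mul_of_nonneg_left hμle hc']
            · rw [Nat.sub_eq_zero_of_le hjS]
              refine le_trans ?_ (abs_nonneg _)
              exact mul_nonpos_of_nonpos_of_nonneg (by simpa using hκ1) hμ.le
        have hcard : ((Finset.Icc (-4 : ℤ) 4).erase 0).card = 8 := by decide
        rw [relWeight_succ]
        have h5 := Finset.sum_le_card_nsmul _ _ _ h2
        rw [hcard, nsmul_eq_mul] at h5
        have h6 : scale m q i / |(v : ℝ)| ≤ scale m q (i + 1) / |(v : ℝ)| / q := by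
          rw [div_div, mul_comm |(v : ℝ)| q, ← div_div]
          gcongr
          rw [le_div_iff₀ (by linarith)]
          linarith
        have h7 : 1 ≤ M * (scale m q (i + 1) / |(v : ℝ)|) := by
          rw [← mul_div_assoc, one_le_div hv0]
          exact hsmall
        set ρ := scale m q (i + 1) / |(v : ℝ)| with hρ
        set W := δ ^ (S + 1) * U with hW
        have hW0 : 0 ≤ W := by positivity
        have hq0 : q - 1 ≠ 0 := by linarith
        have hq00 : q ≠ 0 := by linarith
        have h8 : 8 * K * W ≤ B * W * (ρ - ρ / q) := by
          have : B * W * (ρ - ρ / q) = 8 * K * W * (M * ρ) := by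
            rw [hB]
            field_simp
          rw [this]
          exact le_mul_of_one_le_right (by positivity) h7
        have h9 : B * W * (scale m q i / |(v : ℝ)|) ≤ B * W * (ρ / q) := by gcongr
        have e1 : B * δ ^ (S + 1) * U = B * W := by rw [hW]; ring
        have e2 : K * δ ^ (S + 1) * U = K * W := by rw [hW]; ring
        rw [e1] at h1 ⊢
        rw [e2] at h5
        push_cast at h5
        nlinarith
    have hμ := h.scale_pos i
    have hv0 : 0 < |(v : ℝ)| := lt_of_lt_of_le (mul_pos hc hμ) hv
    calc relWeight m δ i v ≤ B * δ ^ (S + 1) * U * (scale m q i / |(v : ℝ)|) := key i hi v hv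
      _ ≤ B * δ ^ (S + 1) * U * (1 / κ) := by
        gcongr ?_ * ?_
        rw [div_le_div_iff₀ hv0 hκ]
        push_cast at hv
        nlinarith [mul_nonneg hS hμ.le]
      _ = (B / κ) * δ ^ (S + 1) * U := by ring
      _ ≤ _ := by gcongr; exact le_max_right _ _

/-- Passing from level `k` to level `k + 1` multiplies the largest weighted count by at most
`1 + C δ ^ r`. If `|v|` is not small against `m_{k+1}`, the remainder costs a factor `δ` and the
count does not grow. If `|v|` is small, using `m_{k+1}` at all forces at least `r` terms, because
`m_{k+1}` exceeds any sum of `r - 2` earlier terms by a fixed proportion. -/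
theorem IsLacunary.exists_relWeight_le {m : ℕ → ℤ} {q : ℝ} (h : IsLacunary m q) {r : ℕ}
    (hr : 2 ≤ r) (hrq : (r : ℝ) - 2 < q) :
    ∃ C δ₀ : ℝ, 0 < C ∧ 0 < δ₀ ∧ ∀ δ, 0 ≤ δ → δ ≤ δ₀ → ∀ k v,
      relWeight m δ k v ≤ (1 + C * δ ^ r) ^ k := by
  have hq := h.one_lt
  have hr' : (2 : ℝ) ≤ r := by exact_mod_cast hr
  -- half of the relative gap between `m_{k+1}` and a sum of `r - 2` earlier terms
  obtain ⟨κ, hκ, hκ1, hκr⟩ : ∃ κ : ℝ, 0 < κ ∧ κ ≤ 1 / 2 ∧ (κ + r - 2) / q ≤ 1 - κ := by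
    refine ⟨(1 - (r - 2) / q) / 2, ?_, ?_, ?_⟩
    · have : ((r : ℝ) - 2) / q < 1 := by rwa [div_lt_one (by linarith)]
      linarith
    · have : 0 ≤ ((r : ℝ) - 2) / q := div_nonneg (by linarith) (by linarith)
      linarith
    · rw [div_le_iff₀ (by linarith)]
      have : 0 < (q - (r - 2)) := by linarith
      have e : (1 - (r - 2) / q) / 2 * q = (q - (r - 2)) / 2 := by field_simp
      have e2 : (1 - (r - 2) / q) / 2 ≤ (q - (r - 2)) / 2 := by
        rw [← e]
        refine le_mul_of_one_le_right ?_ hq.le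
        have : ((r : ℝ) - 2) / q < 1 := by rwa [div_lt_one (by linarith)]
        linarith
      rw [sub_mul, e]
      linarith
  obtain ⟨K, hK1, hK⟩ := h.relWeight_far hκ (by linarith) r
  refine ⟨8 * K, 1 / (K + 8), by positivity, by positivity, fun δ hδ hδ0 => ?_⟩
  have hδK : δ * (K + 8) ≤ 1 := by rwa [le_div_iff₀ (by positivity)] at hδ0
  have hδ1 : δ ≤ 1 := by nlinarith
  have hcard : ((Finset.Icc (-4 : ℤ) 4).erase 0).card = 8 := by decide
  have main : ∀ k, ∀ i ≤ k, ∀ v, relWeight m δ i v ≤ (1 + 8 * K * δ ^ r) ^ k := by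
    intro k
    have hx : 0 ≤ 8 * K * δ ^ r := by positivity
    induction k with
    | zero =>
      intro i hi v
      obtain rfl : i = 0 := by omega
      rw [relWeight]
      split_ifs <;> simp
    | succ k ih =>
      intro i hi v
      set U := (1 + 8 * K * δ ^ r) ^ k with hU
      have hU0 : 0 < U := by positivity
      have hUs : U ≤ (1 + 8 * K * δ ^ r) ^ (k + 1) := by
        rw [pow_succ]
        exact le_mul_of_one_le_right hU0.le (by linarith)
      rcases Nat.lt_or_ge k i with hik | hik
      swap
      · exact (ih i hik v).trans hUs
      obtain rfl : i = k + 1 := by omega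
      have hμ := h.scale_pos k
      have hμ' := h.scale_pos (k + 1)
      have hqμ := h.mul_scale_le k
      have hμle : scale m q k ≤ scale m q (k + 1) := by nlinarith
      rw [relWeight_succ]
      rcases le_or_gt (κ * scale m q (k + 1)) |(v : ℝ)| with hv | hv
      · have h1 : relWeight m δ k v ≤ K * δ ^ 1 * U := by
          refine hK δ U k hδ hδ1 ih 1 (by omega) k le_rfl v ?_
          simp only [Nat.cast_one, add_sub_cancel_right]
          exact le_trans (by gcongr) hv
        have h2 : ∀ j ∈ (Finset.Icc (-4 : ℤ) 4).erase 0,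
            δ ^ j.natAbs * relWeight m δ k (v + j * m (k + 1)) ≤ δ * U := by
          intro j hj
          obtain ⟨hj4, hj1⟩ := natAbs_bounds_of_mem hj
          refine mul_le_mul ?_ (ih k le_rfl _) (relWeight_nonneg m hδ _ _) hδ
          exact (pow_le_pow_of_le_one hδ hδ1 hj1).trans_eq (pow_one δ)
        have h5 := Finset.sum_le_card_nsmul _ _ _ h2
        rw [hcard, nsmul_eq_mul] at h5
        push_cast at h5
        refine le_trans ?_ hUs
        nlinarith
      · have h2 : ∀ j ∈ (Finset.Icc (-4 : ℤ) 4).erase 0,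
            δ ^ j.natAbs * relWeight m δ k (v + j * m (k + 1)) ≤ K * δ ^ r * U := by
          intro j hj
          obtain ⟨hj4, hj1⟩ := natAbs_bounds_of_mem hj
          have hm : (0 : ℝ) < m (k + 1) := by rwa [scale_succ] at hμ'
          have h4 := hK δ U k hδ hδ1 ih (r - j.natAbs) (by omega) k le_rfl
            (v + j * m (k + 1)) ?_
          · calc _ ≤ δ ^ j.natAbs * (K * δ ^ (r - j.natAbs) * U) := by gcongr
              _ = K * δ ^ (j.natAbs + (r - j.natAbs)) * U := by rw [pow_add]; ring
              _ ≤ _ := by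
                gcongr ?_ * ?_ * _
                exact pow_le_pow_of_le_one hδ hδ1 (by omega)
          · rcases Nat.lt_or_ge j.natAbs r with hjr | hjr
            · rw [Nat.cast_sub hjr.le]
              have h3 : (j.natAbs : ℝ) * m (k + 1) - |(v : ℝ)| ≤
                  |((v + j * m (k + 1) : ℤ) : ℝ)| := by
                have := abs_sub_abs_le_abs_sub ((j : ℝ) * m (k + 1)) (-(v : ℝ))
                rw [abs_neg, abs_mul, abs_of_pos hm, ← Int.cast_abs, ← Nat.cast_natAbs,
                  sub_neg_eq_add, add_comm _ (v : ℝ)] at this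
                push_cast at this ⊢
                exact this
              refine le_trans ?_ h3
              rw [scale_succ] at hv hqμ
              have hj' : (j.natAbs : ℝ) + 1 ≤ r := by exact_mod_cast hjr
              have hj1' : (1 : ℝ) ≤ j.natAbs := by exact_mod_cast hj1
              have hc' : 0 ≤ κ + ((r : ℝ) - j.natAbs) - 1 := by linarith
              have e1 : (κ + ((r : ℝ) - j.natAbs) - 1) * scale m q k ≤
                  (κ + r - 2) * (m (k + 1) / q) := by
                have : scale m q k ≤ m (k + 1) / q := by
                  rw [le_div_iff₀ (by linarith)]; linarith
                apply mul_le_mul (by linarith) this hμ.le (by linarith)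
              have e2 : (κ + r - 2) * (m (k + 1) / q) ≤ (1 - κ) * m (k + 1) := by
                rw [← mul_div_assoc, ← div_mul_eq_mul_div]
                gcongr
              nlinarith
            · rw [Nat.sub_eq_zero_of_le hjr]
              refine le_trans ?_ (abs_nonneg _)
              refine mul_nonpos_of_nonpos_of_nonneg ?_ hμ.le
              push_cast
              linarith
        have h5 := Finset.sum_le_card_nsmul _ _ _ h2
        rw [hcard, nsmul_eq_mul] at h5
        push_cast at h5
        have h6 := ih k le_rfl v
        rw [pow_succ, ← hU]
        nlinarith
  exact fun k v => main k k le_rfl v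

/-! ### Products of lacunary trigonometric polynomials -/

/-- The character `x ↦ e^{2πivx}` of the circle, as a function on the line. -/
noncomputable def trigExp (v : ℤ) (x : ℝ) : ℂ := Complex.exp (2 * Real.pi * v * x * Complex.I)

theorem trigExp_zero (x : ℝ) : trigExp 0 x = 1 := by simp [trigExp]

theorem trigExp_add (v w : ℤ) (x : ℝ) : trigExp (v + w) x = trigExp v x * trigExp w x := by
  rw [trigExp, trigExp, trigExp, ← Complex.exp_add]
  congr 1
  push_cast
  ring

theorem continuous_trigExp (v : ℤ) : Continuous (trigExp v) := by
  unfold trigExp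
  fun_prop

theorem integral_trigExp (v : ℤ) : ∫ x in (0 : ℝ)..1, trigExp v x = if v = 0 then 1 else 0 := by
  split_ifs with hv
  · subst hv
    simp [trigExp_zero]
  · have hc : (2 * Real.pi * v * Complex.I : ℂ) ≠ 0 := by
      have : (Real.pi : ℂ) ≠ 0 := by exact_mod_cast Real.pi_ne_zero
      have : (v : ℂ) ≠ 0 := by exact_mod_cast hv
      simp_all
    have h1 : ∀ x : ℝ, trigExp v x = Complex.exp ((2 * Real.pi * v * Complex.I) * x) := by
      intro x
      rw [trigExp]
      ring_nf
    simp_rw [h1]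
    rw [integral_exp_mul_complex hc]
    have h2 : Complex.exp (2 * Real.pi * v * Complex.I * (1 : ℝ)) = 1 := by
      rw [Complex.exp_eq_one_iff]
      exact ⟨v, by push_cast; ring⟩
    rw [h2]
    simp

/-- The mean over `[0, 1]` of `e^{2πivx} ∏_{i=1}^k Q_i(m_i x)`, where `Q_i` is the trigonometric
polynomial `∑_{|j| ≤ 4} c i j e^{2πij·}`. -/
noncomputable def prodCoeff (c : ℕ → ℤ → ℂ) (m : ℕ → ℤ) (k : ℕ) (v : ℤ) : ℂ :=
  ∫ x in (0 : ℝ)..1, trigExp v x *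
    ∏ i ∈ Finset.Icc 1 k, ∑ j ∈ Finset.Icc (-4 : ℤ) 4, c i j * trigExp (j * m i) x

theorem prodCoeff_zero (c : ℕ → ℤ → ℂ) (m : ℕ → ℤ) (v : ℤ) :
    prodCoeff c m 0 v = if v = 0 then 1 else 0 := by
  simp [prodCoeff, integral_trigExp]

theorem prodCoeff_succ (c : ℕ → ℤ → ℂ) (m : ℕ → ℤ) (k : ℕ) (v : ℤ) :
    prodCoeff c m (k + 1) v =
      ∑ j ∈ Finset.Icc (-4 : ℤ) 4, c (k + 1) j * prodCoeff c m k (v + j * m (k + 1)) := by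
  simp only [prodCoeff]
  simp_rw [← intervalIntegral.integral_const_mul]
  rw [← intervalIntegral.integral_finsetSum]
  · refine intervalIntegral.integral_congr fun x _ => ?_
    rw [Finset.prod_Icc_succ_top (by omega), ← mul_assoc, Finset.mul_sum]
    refine Finset.sum_congr rfl fun j _ => ?_
    rw [trigExp_add]
    ring
  · intro j _
    apply Continuous.intervalIntegrable
    have := continuous_trigExp
    fun_prop

theorem norm_prodCoeff_le {c : ℕ → ℤ → ℂ} (m : ℕ → ℤ) {δ : ℝ} (hδ : 0 ≤ δ) {n : ℕ}
    (hc : ∀ k ∈ Finset.Icc 1 n, ∀ j ∈ Finset.Icc (-4 : ℤ) 4, ‖c k j‖ ≤ δ ^ j.natAbs)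
    {k : ℕ} (hk : k ≤ n) (v : ℤ) :
    ‖prodCoeff c m k v‖ ≤ relWeight m δ k v := by
  induction k generalizing v with
  | zero =>
    rw [prodCoeff_zero, relWeight]
    split_ifs <;> simp
  | succ k ih =>
    rw [prodCoeff_succ, relWeight]
    refine norm_sum_le_of_le _ fun j hj => ?_
    rw [norm_mul]
    exact mul_le_mul (hc _ (by simp; omega) j hj) (ih (by omega) _) (norm_nonneg _) (by positivity)

/-- When every factor has mean `1`, the trivial relation contributes exactly `1` to the mean of the
product, and the nontrivial relations account for the difference. -/
theorem norm_prodCoeff_sub_one_le {c : ℕ → ℤ → ℂ} (m : ℕ → ℤ) {δ : ℝ} (hδ : 0 ≤ δ) {n : ℕ}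
    (hc : ∀ k ∈ Finset.Icc 1 n, ∀ j ∈ Finset.Icc (-4 : ℤ) 4, ‖c k j‖ ≤ δ ^ j.natAbs)
    (hc0 : ∀ k ∈ Finset.Icc 1 n, c k 0 = 1) {k : ℕ} (hk : k ≤ n) :
    ‖prodCoeff c m k 0 - 1‖ ≤ relWeight m δ k 0 - 1 := by
  induction k with
  | zero => simp [prodCoeff_zero, relWeight]
  | succ k ih =>
    have hk1 : k + 1 ∈ Finset.Icc 1 n := by simp; omega
    rw [prodCoeff_succ, ← Finset.add_sum_erase _ _ (by simp : (0 : ℤ) ∈ Finset.Icc (-4 : ℤ) 4),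
      relWeight_succ, hc0 _ hk1, one_mul, zero_mul, zero_add, add_sub_right_comm,
      add_sub_right_comm]
    refine (norm_add_le _ _).trans (add_le_add (ih (by omega)) ?_)
    refine norm_sum_le_of_le _ fun j hj => ?_
    rw [norm_mul]
    exact mul_le_mul (hc _ hk1 j (Finset.mem_of_mem_erase hj))
      (norm_prodCoeff_le m hδ hc (by omega) _) (norm_nonneg _) (by positivity)

/-! ### The Taylor polynomial of the exponential -/

/-- The Fourier coefficients of the degree four Taylor polynomial `∑_{p ≤ 4} (i y cos θ) ^ p / p!`,
divided by its mean `(1 - y ^ 2 / 8) ^ 2`. -/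
noncomputable def taylorCoeff (y : ℝ) (j : ℤ) : ℂ :=
  match j.natAbs with
  | 0 => 1
  | 1 => Complex.I * (y / 2 - y ^ 3 / 16) / (1 - y ^ 2 / 8) ^ 2
  | 2 => (-(y ^ 2 / 8) + y ^ 4 / 96) / (1 - y ^ 2 / 8) ^ 2
  | 3 => -Complex.I * (y ^ 3 / 48) / (1 - y ^ 2 / 8) ^ 2
  | 4 => (y ^ 4 / 384) / (1 - y ^ 2 / 8) ^ 2
  | _ => 0

theorem taylorCoeff_zero (y : ℝ) : taylorCoeff y 0 = 1 := rfl

theorem norm_taylorCoeff_le {y δ : ℝ} (hyδ : |y| ≤ δ) (hδ : δ ≤ 1) (j : ℤ) :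
    ‖taylorCoeff y j‖ ≤ δ ^ j.natAbs := by
  have hδ0 : 0 ≤ δ := (abs_nonneg y).trans hyδ
  have hy1 : |y| ≤ 1 := hyδ.trans hδ
  have hy2 : y ^ 2 ≤ 1 := (sq_le_one_iff_abs_le_one y).mpr hy1
  have hD : (3 / 4 : ℝ) ≤ (1 - y ^ 2 / 8) ^ 2 := by nlinarith [sq_nonneg y]
  have hDn : ‖(1 - (y : ℂ) ^ 2 / 8) ^ 2‖ = (1 - y ^ 2 / 8) ^ 2 := by
    have : (1 - (y : ℂ) ^ 2 / 8) ^ 2 = (((1 - y ^ 2 / 8) ^ 2 : ℝ) : ℂ) := by push_cast; ring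
    rw [this, Complex.norm_real, Real.norm_eq_abs, abs_of_nonneg (by positivity)]
  -- each nonconstant coefficient is `y ^ j` times a number of modulus at most `3 / 4`, divided by
  -- `(1 - y ^ 2 / 8) ^ 2`
  have key : ∀ (a : ℂ) (b : ℝ) (p : ℕ), ‖a‖ = |y| ^ p * |b| → |b| ≤ 3 / 4 →
      ‖a / (1 - (y : ℂ) ^ 2 / 8) ^ 2‖ ≤ δ ^ p := by
    intro a b p ha hb
    rw [norm_div, hDn, div_le_iff₀ (by linarith), ha]
    exact mul_le_mul (pow_le_pow_left₀ (abs_nonneg y) hyδ p) (hb.trans hD) (abs_nonneg _)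
      (by positivity)
  unfold taylorCoeff
  split <;> first | rename_i hj; rw [hj] | skip
  · simp
  · refine key _ (1 / 2 - y ^ 2 / 16) 1 ?_ ?_
    · have : Complex.I * (y / 2 - y ^ 3 / 16) =
        Complex.I * ((y * (1 / 2 - y ^ 2 / 16) : ℝ) : ℂ) := by push_cast; ring
      rw [this, norm_mul, Complex.norm_I, one_mul, Complex.norm_real, Real.norm_eq_abs, abs_mul,
        pow_one]
    · rw [abs_le]; constructor <;> nlinarith [sq_nonneg y]
  · refine key _ (-(1 / 8) + y ^ 2 / 96) 2 ?_ ?_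
    · have : (-((y : ℂ) ^ 2 / 8) + y ^ 4 / 96) =
        ((y ^ 2 * (-(1 / 8) + y ^ 2 / 96) : ℝ) : ℂ) := by push_cast; ring
      rw [this, Complex.norm_real, Real.norm_eq_abs, abs_mul, abs_pow]
    · rw [abs_le]; constructor <;> nlinarith [sq_nonneg y]
  · refine key _ (1 / 48) 3 ?_ (by norm_num [abs_of_pos])
    have : -Complex.I * ((y : ℂ) ^ 3 / 48) = -Complex.I * ((y ^ 3 * (1 / 48) : ℝ) : ℂ) := by
      push_cast; ring
    rw [this, norm_mul, norm_neg, Complex.norm_I, one_mul, Complex.norm_real, Real.norm_eq_abs,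
      abs_mul, abs_pow]
  · refine key _ (1 / 384) 4 ?_ (by norm_num [abs_of_pos])
    have : ((y : ℂ) ^ 4 / 384) = ((y ^ 4 * (1 / 384) : ℝ) : ℂ) := by push_cast; ring
    rw [this, Complex.norm_real, Real.norm_eq_abs, abs_mul, abs_pow]
  · simp only [norm_zero]; positivity

theorem taylor_exp_cos_eq {y : ℝ} (hy : |y| ≤ 1) (n : ℤ) (x : ℝ) :
    ∑ p ∈ Finset.range 5,
        (Complex.I * (y * Real.cos (2 * Real.pi * n * x) : ℝ)) ^ p / (p.factorial : ℂ) =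
      ((1 - y ^ 2 / 8 : ℝ) : ℂ) ^ 2 *
        ∑ j ∈ Finset.Icc (-4 : ℤ) 4, taylorCoeff y j * trigExp (j * n) x := by
  have hy2 : y ^ 2 ≤ 1 := (sq_le_one_iff_abs_le_one y).mpr hy
  have hD : ((1 : ℂ) - y ^ 2 / 8) ≠ 0 := by
    have : (1 - y ^ 2 / 8 : ℝ) ≠ 0 := by nlinarith
    exact_mod_cast this
  set z := Complex.exp ((2 * Real.pi * n * x : ℝ) * Complex.I) with hz
  set w := Complex.exp (-((2 * Real.pi * n * x : ℝ) * Complex.I)) with hw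
  have hzw : z * w = 1 := by rw [hz, hw, ← Complex.exp_add, add_neg_cancel, Complex.exp_zero]
  have hpos : ∀ p : ℕ, trigExp (p * n) x = z ^ p := by
    intro p
    rw [trigExp, hz, ← Complex.exp_nat_mul]
    congr 1
    push_cast
    ring
  have hneg : ∀ p : ℕ, trigExp (-p * n) x = w ^ p := by
    intro p
    rw [trigExp, hw, ← Complex.exp_nat_mul]
    congr 1
    push_cast
    ring
  have hcos : ((y * Real.cos (2 * Real.pi * n * x) : ℝ) : ℂ) = y * ((z + w) / 2) := by
    push_cast
    rw [Complex.cos, hz, hw]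
    push_cast
    ring_nf
  have hsum : Finset.Icc (-4 : ℤ) 4 = {-4, -3, -2, -1, 0, 1, 2, 3, 4} := by decide
  have h1 := hpos 1; have h2 := hpos 2; have h3 := hpos 3; have h4 := hpos 4; have h0 := hpos 0
  have g1 := hneg 1; have g2 := hneg 2; have g3 := hneg 3; have g4 := hneg 4
  push_cast at h0 h1 h2 h3 h4 g1 g2 g3 g4
  have e2 : (z + w) ^ 2 = z ^ 2 + w ^ 2 + 2 := by linear_combination 2 * hzw
  have e3 : (z + w) ^ 3 = z ^ 3 + w ^ 3 + 3 * (z + w) := by linear_combination 3 * (z + w) * hzw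
  have e4 : (z + w) ^ 4 = z ^ 4 + w ^ 4 + 4 * (z ^ 2 + w ^ 2) + 6 := by
    linear_combination (4 * z ^ 2 + 4 * w ^ 2 + 6 * (z * w + 1)) * hzw
  have hI2 : Complex.I ^ 2 = -1 := Complex.I_sq
  have hI3 : Complex.I ^ 3 = -Complex.I := Complex.I_pow_three
  have hI4 : Complex.I ^ 4 = 1 := Complex.I_pow_four
  have hD2 : ((1 - y ^ 2 / 8 : ℝ) : ℂ) ^ 2 = (1 - y ^ 2 / 8) ^ 2 := by push_cast; ring
  have hdiv : ∀ a b : ℂ,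
      (1 - (y : ℂ) ^ 2 / 8) ^ 2 * (a / (1 - (y : ℂ) ^ 2 / 8) ^ 2 * b) = a * b := by
    intro a b
    rw [div_mul_eq_mul_div, mul_div_cancel₀ _ (pow_ne_zero 2 hD)]
  rw [hsum, hcos, hD2]
  simp only [Finset.sum_range_succ, Finset.sum_range_zero, mul_pow, div_pow, hI2, hI3, hI4, e2, e3,
    e4]
  repeat rw [Finset.sum_insert (by decide)]
  rw [Finset.sum_singleton, g4, g3, g2, g1, h0, h1, h2, h3, h4]
  have t : ∀ p : ℕ, taylorCoeff y (-(p : ℤ)) = taylorCoeff y p := fun p => by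
    simp [taylorCoeff]
  have t1 := t 1; have t2 := t 2; have t3 := t 3; have t4 := t 4
  push_cast at t1 t2 t3 t4
  rw [t1, t2, t3, t4]
  have s0 : taylorCoeff y 0 = 1 := rfl
  have s1 : taylorCoeff y 1 = Complex.I * (y / 2 - y ^ 3 / 16) / (1 - y ^ 2 / 8) ^ 2 := rfl
  have s2 : taylorCoeff y 2 = (-(y ^ 2 / 8) + y ^ 4 / 96) / (1 - y ^ 2 / 8) ^ 2 := rfl
  have s3 : taylorCoeff y 3 = -Complex.I * (y ^ 3 / 48) / (1 - y ^ 2 / 8) ^ 2 := rfl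
  have s4 : taylorCoeff y 4 = (y ^ 4 / 384) / (1 - y ^ 2 / 8) ^ 2 := rfl
  rw [s0, s1, s2, s3, s4]
  simp only [mul_add, hdiv]
  norm_num [Nat.factorial]
  ring

/-! ### The characteristic function of the lacunary sum -/

theorem norm_exp_I_sub_taylor_le {u : ℝ} (hu : |u| ≤ 1) :
    ‖(∑ p ∈ Finset.range 5, (Complex.I * (u : ℝ)) ^ p / (p.factorial : ℂ)) -
      Complex.exp (Complex.I * u)‖ ≤ |u| ^ 5 := by
  have hn : ‖Complex.I * (u : ℂ)‖ = |u| := by simp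
  have := Complex.exp_bound (x := Complex.I * u) (by rw [hn]; exact hu) (n := 5) (by norm_num)
  rw [norm_sub_rev, hn] at this
  refine this.trans (mul_le_of_le_one_right (by positivity) ?_)
  norm_num [Nat.factorial]

/-- Perturbing each factor of a product of unimodular numbers by at most `b`. -/
theorem norm_prod_sub_prod_exp_le {ι : Type*} (s : Finset ι) (P : ι → ℂ) (u : ι → ℝ) {b : ℝ}
    (h : ∀ i ∈ s, ‖P i - Complex.exp (Complex.I * u i)‖ ≤ b) :
    ‖∏ i ∈ s, P i - ∏ i ∈ s, Complex.exp (Complex.I * u i)‖ ≤ Real.exp (s.card * b) - 1 := by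
  have hnorm : ∀ x : ℝ, ‖Complex.exp (Complex.I * x)‖ = 1 := fun x => by
    rw [mul_comm]; exact Complex.norm_exp_ofReal_mul_I x
  set f : ι → ℂ := fun i => (P i - Complex.exp (Complex.I * u i)) / Complex.exp (Complex.I * u i)
  have hP : ∀ i ∈ s, P i = Complex.exp (Complex.I * u i) * (1 + f i) := by
    intro i _
    have := Complex.exp_ne_zero (Complex.I * u i)
    simp only [f]
    field_simp
    ring
  rw [Finset.prod_congr rfl hP, Finset.prod_mul_distrib, ← mul_sub_one, norm_mul, norm_prod,
    Finset.prod_congr rfl fun i _ => hnorm (u i), Finset.prod_const_one, one_mul]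
  refine (Finset.norm_prod_one_add_sub_one_le s f).trans ?_
  gcongr
  rw [← nsmul_eq_mul]
  refine Finset.sum_le_card_nsmul _ _ _ fun i hi => ?_
  simp only [f]
  rw [norm_div, hnorm, div_one]
  exact h i hi

/-- The characteristic function of `S_n` with respect to Lebesgue measure on `[0, 1]`. -/
noncomputable def sumCharFun (a : ℕ → ℕ → ℝ) (m : ℕ → ℤ) (n : ℕ) (t : ℝ) : ℂ :=
  ∫ x in (0 : ℝ)..1, Complex.exp (Complex.I * (t * partialSum a m n x : ℝ))

/-- Replacing every factor `e^{i t a_k cos(2π m_k x)}` by its Taylor polynomial. -/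
theorem norm_sumCharFun_sub_le (a : ℕ → ℕ → ℝ) (m : ℕ → ℤ) (n : ℕ) {t δ : ℝ} (hδ : δ ≤ 1)
    (h : ∀ k ∈ Finset.Icc 1 n, |t * a k n| ≤ δ) :
    ‖((∏ k ∈ Finset.Icc 1 n, (1 - (t * a k n) ^ 2 / 8) ^ 2 : ℝ) : ℂ) *
        prodCoeff (fun k => taylorCoeff (t * a k n)) m n 0 - sumCharFun a m n t‖ ≤
      Real.exp (n * δ ^ 5) - 1 := by
  rw [prodCoeff, sumCharFun, ← intervalIntegral.integral_const_mul,
    ← intervalIntegral.integral_sub]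
  rotate_left
  · apply Continuous.intervalIntegrable
    have := continuous_trigExp
    fun_prop
  · apply Continuous.intervalIntegrable
    unfold partialSum
    fun_prop
  have hb : ∀ x ∈ Set.uIoc (0 : ℝ) 1,
      ‖((∏ k ∈ Finset.Icc 1 n, (1 - (t * a k n) ^ 2 / 8) ^ 2 : ℝ) : ℂ) *
        (trigExp 0 x * ∏ i ∈ Finset.Icc 1 n, ∑ j ∈ Finset.Icc (-4 : ℤ) 4,
          taylorCoeff (t * a i n) j * trigExp (j * m i) x) -
        Complex.exp (Complex.I * (t * partialSum a m n x : ℝ))‖ ≤ Real.exp (n * δ ^ 5) - 1 := by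
    intro x _
    have e1 : Complex.exp (Complex.I * (t * partialSum a m n x : ℝ)) = ∏ k ∈ Finset.Icc 1 n,
        Complex.exp (Complex.I * (t * a k n * Real.cos (2 * Real.pi * m k * x) : ℝ)) := by
      rw [← Complex.exp_sum, partialSum, Finset.mul_sum, Complex.ofReal_sum, Finset.mul_sum]
      simp_rw [mul_assoc]
    have e2 : ((∏ k ∈ Finset.Icc 1 n, (1 - (t * a k n) ^ 2 / 8) ^ 2 : ℝ) : ℂ) *
        (trigExp 0 x * ∏ i ∈ Finset.Icc 1 n, ∑ j ∈ Finset.Icc (-4 : ℤ) 4,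
          taylorCoeff (t * a i n) j * trigExp (j * m i) x) =
        ∏ k ∈ Finset.Icc 1 n, ∑ p ∈ Finset.range 5,
        (Complex.I * (t * a k n * Real.cos (2 * Real.pi * m k * x) : ℝ)) ^ p /
          (p.factorial : ℂ) := by
      rw [trigExp_zero, one_mul, Complex.ofReal_prod, ← Finset.prod_mul_distrib]
      refine Finset.prod_congr rfl fun k hk => ?_
      rw [taylor_exp_cos_eq ((h k hk).trans hδ), Complex.ofReal_pow]
    rw [e1, e2]
    have := norm_prod_sub_prod_exp_le (Finset.Icc 1 n) (fun k => ∑ p ∈ Finset.range 5,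
        (Complex.I * (t * a k n * Real.cos (2 * Real.pi * m k * x) : ℝ)) ^ p /
          (p.factorial : ℂ)) (fun k => t * a k n * Real.cos (2 * Real.pi * m k * x))
          (b := δ ^ 5) ?_
    · simpa using this
    · intro k hk
      have hu : |t * a k n * Real.cos (2 * Real.pi * m k * x)| ≤ δ := by
        rw [abs_mul]
        exact (mul_le_of_le_one_right (abs_nonneg _) (Real.abs_cos_le_one _)).trans (h k hk)
      exact (norm_exp_I_sub_taylor_le (hu.trans hδ)).trans (pow_le_pow_left₀ (abs_nonneg _) hu 5)
  simpa using intervalIntegral.norm_integral_le_of_norm_le_const hb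

/-- The product of the means `(1 - y ^ 2 / 8) ^ 2 = 1 - y ^ 2 / 4 + O(y ^ 4)` of the Taylor
polynomials agrees with the Gaussian factor up to a small relative error. -/
theorem exp_sub_prod_sq_le {ι : Type*} (s : Finset ι) (y : ι → ℝ) {δ : ℝ}
    (hδ : δ ≤ 1) (h : ∀ k ∈ s, |y k| ≤ δ) :
    0 ≤ Real.exp (-(∑ k ∈ s, y k ^ 2) / 4) - ∏ k ∈ s, (1 - y k ^ 2 / 8) ^ 2 ∧
    Real.exp (-(∑ k ∈ s, y k ^ 2) / 4) - ∏ k ∈ s, (1 - y k ^ 2 / 8) ^ 2 ≤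
      s.card * δ ^ 4 * Real.exp (-(∑ k ∈ s, y k ^ 2) / 4) := by
  rw [neg_div, Finset.sum_div, ← Finset.sum_neg_distrib, Real.exp_sum]
  have hy2 : ∀ k ∈ s, y k ^ 2 ≤ 1 := fun k hk =>
    (sq_le_one_iff_abs_le_one _).mpr ((h k hk).trans hδ)
  constructor
  · rw [sub_nonneg]
    refine Finset.prod_le_prod (fun k _ => by positivity) fun k hk => ?_
    have h1 := Real.add_one_le_exp (-(y k ^ 2 / 8))
    have := hy2 k hk
    calc (1 - y k ^ 2 / 8) ^ 2 ≤ Real.exp (-(y k ^ 2 / 8)) ^ 2 :=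
          pow_le_pow_left₀ (by linarith) (by linarith) 2
      _ = _ := by rw [← Real.exp_nat_mul]; congr 1; push_cast; ring
  · have h2 : (∏ k ∈ s, Real.exp (-(y k ^ 2 / 4))) * (1 - s.card * δ ^ 4) ≤
        ∏ k ∈ s, (1 - y k ^ 2 / 8) ^ 2 := by
      calc _ ≤ (∏ k ∈ s, Real.exp (-(y k ^ 2 / 4))) * Real.exp (-(s.card * δ ^ 4)) := by
            gcongr
            linarith [Real.add_one_le_exp (-(s.card * δ ^ 4))]
        _ = ∏ k ∈ s, (Real.exp (-(y k ^ 2 / 4)) * Real.exp (-δ ^ 4)) := by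
            rw [Finset.prod_mul_distrib, Finset.prod_const, ← Real.exp_nat_mul]
            congr 2
            ring
        _ ≤ _ := by
            refine Finset.prod_le_prod (fun k _ => by positivity) fun k hk => ?_
            have h0 := hy2 k hk
            have h4 : y k ^ 4 ≤ δ ^ 4 := by
              have := pow_le_pow_left₀ (abs_nonneg _) (h k hk) 4
              rwa [← abs_pow, abs_of_nonneg (by positivity)] at this
            -- `e^{-x-x²} ≤ 1 - x` with `x = y² / 8`
            have h5 : 1 / (1 - y k ^ 2 / 8) ≤ Real.exp (y k ^ 2 / 8 + δ ^ 4 / 2) := by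
              have h6 := Real.add_one_le_exp (y k ^ 2 / 8 + δ ^ 4 / 2)
              refine le_trans ?_ h6
              rw [div_le_iff₀ (by linarith)]
              have hδ4 : 0 ≤ δ ^ 4 := le_trans (by positivity) h4
              nlinarith [mul_nonneg hδ4 (sub_nonneg.mpr h0)]
            have h7 : Real.exp (-(y k ^ 2 / 8 + δ ^ 4 / 2)) ≤ 1 - y k ^ 2 / 8 := by
              rw [Real.exp_neg]
              rw [one_div] at h5
              exact inv_le_of_inv_le₀ (by linarith) h5
            rw [← Real.exp_add]
            calc _ = Real.exp (-(y k ^ 2 / 8 + δ ^ 4 / 2)) ^ 2 := by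
                  rw [← Real.exp_nat_mul]; congr 1; push_cast; ring
              _ ≤ _ := pow_le_pow_left₀ (Real.exp_pos _).le h7 2
    linarith

theorem normA_sq (a : ℕ → ℕ → ℝ) (n : ℕ) :
    normA a n ^ 2 = 1 / 2 * ∑ k ∈ Finset.Icc 1 n, a k n ^ 2 :=
  Real.sq_sqrt (mul_nonneg (by norm_num) (Finset.sum_nonneg fun _ _ => sq_nonneg _))

/-- The error has a part relative to the Gaussian, from the nontrivial relations and from the means
of the Taylor polynomials, and an absolute part, from the Taylor remainders. -/
theorem IsLacunary.norm_sumCharFun_sub_exp_le {m : ℕ → ℤ} {q : ℝ} (hm : IsLacunary m q) {r : ℕ}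
    (hr : 2 ≤ r) (hrq : (r : ℝ) - 2 < q) (a : ℕ → ℕ → ℝ) :
    ∃ C δ₀ : ℝ, 0 < C ∧ 0 < δ₀ ∧ ∀ (δ : ℝ) (n : ℕ) (t : ℝ), 0 ≤ δ → δ ≤ δ₀ →
      (∀ k ∈ Finset.Icc 1 n, |t * a k n| ≤ δ) →
      ‖sumCharFun a m n t - (Real.exp (-(t ^ 2 * normA a n ^ 2 / 2)) : ℝ)‖ ≤
        (Real.exp (n * (C * δ ^ r)) - 1 + n * δ ^ 4) * Real.exp (-(t ^ 2 * normA a n ^ 2 / 2)) +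
          (Real.exp (n * δ ^ 5) - 1) := by
  obtain ⟨C, δ₀, hC, hδ₀, hF⟩ := hm.exists_relWeight_le hr hrq
  refine ⟨C, min δ₀ 1, hC, by positivity, fun δ n t hδ hδle h => ?_⟩
  have hδ1 : δ ≤ 1 := hδle.trans (min_le_right _ _)
  have h1 := norm_sumCharFun_sub_le a m n hδ1 h
  have hG : Real.exp (-(t ^ 2 * normA a n ^ 2 / 2)) =
      Real.exp (-(∑ k ∈ Finset.Icc 1 n, (t * a k n) ^ 2) / 4) := by
    rw [normA_sq]
    simp_rw [mul_pow]
    rw [← Finset.mul_sum]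
    congr 1
    ring
  obtain ⟨h2, h3⟩ := exp_sub_prod_sq_le (Finset.Icc 1 n) (fun k => t * a k n) hδ1 h
  rw [← hG] at h2 h3
  rw [Nat.card_Icc, Nat.add_sub_cancel] at h3
  set G := Real.exp (-(t ^ 2 * normA a n ^ 2 / 2))
  set D := ∏ k ∈ Finset.Icc 1 n, (1 - (t * a k n) ^ 2 / 8) ^ 2
  have hD0 : 0 ≤ D := Finset.prod_nonneg fun _ _ => by positivity
  set I := prodCoeff (fun k => taylorCoeff (t * a k n)) m n 0
  have h4 : ‖I - 1‖ ≤ Real.exp (n * (C * δ ^ r)) - 1 := by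
    refine (norm_prodCoeff_sub_one_le m hδ (fun k hk j _ => norm_taylorCoeff_le (h k hk) hδ1 j)
      (fun _ _ => taylorCoeff_zero _) le_rfl).trans ?_
    gcongr
    refine (hF δ hδ (hδle.trans (min_le_left _ _)) n 0).trans ?_
    rw [Real.exp_nat_mul]
    gcongr
    linarith [Real.add_one_le_exp (C * δ ^ r)]
  have e : sumCharFun a m n t - (G : ℂ) =
      -((D : ℂ) * I - sumCharFun a m n t) + ((D : ℂ) * (I - 1) - ((G - D : ℝ) : ℂ)) := by
    push_cast
    ring
  have h5 : ‖(D : ℂ) * (I - 1)‖ ≤ G * (Real.exp (n * (C * δ ^ r)) - 1) := by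
    rw [norm_mul, Complex.norm_real, Real.norm_of_nonneg hD0]
    exact mul_le_mul (by linarith) h4 (norm_nonneg _) (by linarith)
  have h6 : ‖((G - D : ℝ) : ℂ)‖ ≤ n * δ ^ 4 * G := by
    rwa [Complex.norm_real, Real.norm_of_nonneg h2]
  rw [e]
  refine (norm_add_le _ _).trans ?_
  rw [norm_neg]
  have := norm_sub_le ((D : ℂ) * (I - 1)) ((G - D : ℝ) : ℂ)
  nlinarith

theorem abs_le_maxCoeff (a : ℕ → ℕ → ℝ) {n k : ℕ} (hk : k ∈ Finset.Icc 1 n) :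
    |a k n| ≤ maxCoeff a n := by
  have : ‖a k n‖₊ ≤ (Finset.Icc 1 n).sup fun k => ‖a k n‖₊ :=
    Finset.le_sup (f := fun k => ‖a k n‖₊) hk
  exact_mod_cast this

theorem maxCoeff_nonneg (a : ℕ → ℕ → ℝ) (n : ℕ) : 0 ≤ maxCoeff a n := NNReal.coe_nonneg _

/-- This keeps the absolute error of `norm_sumCharFun_sub_exp_le` negligible after multiplication by
`A_n`. -/
theorem normA_le (a : ℕ → ℕ → ℝ) (n : ℕ) : normA a n ≤ Real.sqrt n * maxCoeff a n := by
  refine Real.sqrt_le_iff.mpr ⟨mul_nonneg (Real.sqrt_nonneg _) (maxCoeff_nonneg a n), ?_⟩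
  rw [mul_pow, Real.sq_sqrt (Nat.cast_nonneg n)]
  have : ∑ k ∈ Finset.Icc 1 n, a k n ^ 2 ≤ n * maxCoeff a n ^ 2 := by
    have := Finset.sum_le_card_nsmul (Finset.Icc 1 n) (fun k => a k n ^ 2) (maxCoeff a n ^ 2)
      fun k hk => by
        rw [← sq_abs]
        exact pow_le_pow_left₀ (abs_nonneg _) (abs_le_maxCoeff a hk) 2
    simpa using this
  have h0 : 0 ≤ ∑ k ∈ Finset.Icc 1 n, a k n ^ 2 := Finset.sum_nonneg fun _ _ => sq_nonneg _
  linarith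

theorem tendsto_nat_mul_pow_of_rpow {d : ℕ → ℝ} (hd : ∀ n, 0 ≤ d n) {ε : ℝ} (hε : 0 < ε) {r : ℕ}
    (h : Tendsto (fun n : ℕ => (n : ℝ) ^ (1 + ε) * d n ^ r) atTop (𝓝 0)) :
    Tendsto (fun n : ℕ => (n : ℝ) * d n ^ r) atTop (𝓝 0) := by
  refine squeeze_zero' (Eventually.of_forall fun n => ?_) ?_ h
  · have := hd n
    positivity
  · filter_upwards [eventually_ge_atTop 1] with n hn
    have hn' : (1 : ℝ) ≤ n := by exact_mod_cast hn
    have := pow_nonneg (hd n) r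
    gcongr
    calc (n : ℝ) = (n : ℝ) ^ (1 : ℝ) := (Real.rpow_one _).symm
      _ ≤ _ := Real.rpow_le_rpow_of_exponent_le hn' (by linarith)

theorem tendsto_zero_of_nat_mul_pow {d : ℕ → ℝ} (hd : ∀ n, 0 ≤ d n) {r : ℕ} (hr : r ≠ 0)
    (h : Tendsto (fun n : ℕ => (n : ℝ) * d n ^ r) atTop (𝓝 0)) : Tendsto d atTop (𝓝 0) := by
  have h1 : Tendsto (fun n => d n ^ r) atTop (𝓝 0) := by
    refine squeeze_zero' (Eventually.of_forall fun n => pow_nonneg (hd n) r) ?_ h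
    filter_upwards [eventually_ge_atTop 1] with n hn
    have hn' : (1 : ℝ) ≤ n := by exact_mod_cast hn
    exact le_mul_of_one_le_left (pow_nonneg (hd n) r) hn'
  have h2 := h1.rpow_const (p := (r : ℝ)⁻¹) (Or.inr (by positivity))
  rw [Real.zero_rpow (by positivity)] at h2
  refine h2.congr fun n => ?_
  exact Real.pow_rpow_inv_natCast (hd n) hr

/-- On a compact interval the characteristic function of `S_n` is a centred Gaussian one, up to a
relative error tending to `0` and an absolute error that is `o(1 / A_n)`. -/
theorem IsLacunary.exists_sumCharFun_approx {m : ℕ → ℤ} {q : ℝ} (hm : IsLacunary m q) {r : ℕ}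
    (hr : 2 ≤ r) (hr4 : r ≤ 4) (hrq : (r : ℝ) - 2 < q) (a : ℕ → ℕ → ℝ)
    (hd : Tendsto (fun n : ℕ => (n : ℝ) * maxCoeff a n ^ r) atTop (𝓝 0)) {T : ℝ} (hT : 0 < T) :
    ∃ η E : ℕ → ℝ, Tendsto η atTop (𝓝 0) ∧ Tendsto (fun n => normA a n * E n) atTop (𝓝 0) ∧
      ∀ᶠ n in atTop, ∀ t, |t| ≤ T →
        ‖sumCharFun a m n t - (Real.exp (-(t ^ 2 * normA a n ^ 2 / 2)) : ℝ)‖ ≤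
          η n * Real.exp (-(t ^ 2 * normA a n ^ 2 / 2)) + E n := by
  obtain ⟨C, δ₀, hC, hδ₀, hF⟩ := hm.norm_sumCharFun_sub_exp_le hr hrq a
  set d := maxCoeff a with hddef
  have hd0 : ∀ n, 0 ≤ d n := maxCoeff_nonneg a
  have hdlim : Tendsto d atTop (𝓝 0) := tendsto_zero_of_nat_mul_pow hd0 (by omega) hd
  have hd4 : Tendsto (fun n : ℕ => (n : ℝ) * d n ^ 4) atTop (𝓝 0) := by
    have h1 := hd.mul (hdlim.pow (4 - r))
    rw [zero_mul] at h1
    refine h1.congr fun n => ?_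
    rw [mul_assoc, ← pow_add, Nat.add_sub_cancel' hr4]
  have hd5 : Tendsto (fun n : ℕ => (n : ℝ) * (T * d n) ^ 5) atTop (𝓝 0) := by
    have h1 := (hd4.mul hdlim).const_mul (T ^ 5)
    simp only [mul_zero] at h1
    exact h1.congr fun n => by ring
  refine ⟨fun n => Real.exp (n * (C * (T * d n) ^ r)) - 1 + n * (T * d n) ^ 4,
    fun n => Real.exp (n * (T * d n) ^ 5) - 1, ?_, ?_, ?_⟩
  · have h1 : Tendsto (fun n : ℕ => (n : ℝ) * (C * (T * d n) ^ r)) atTop (𝓝 0) := by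
      have := hd.const_mul (C * T ^ r)
      rw [mul_zero] at this
      exact this.congr fun n => by rw [mul_pow]; ring
    have h2 : Tendsto (fun n : ℕ => (n : ℝ) * (T * d n) ^ 4) atTop (𝓝 0) := by
      have := hd4.const_mul (T ^ 4)
      rw [mul_zero] at this
      exact this.congr fun n => by ring
    have h3 := ((Real.continuous_exp.tendsto 0).comp h1).sub_const 1 |>.add h2
    simpa using h3
  · have hlim : Tendsto (fun n : ℕ => 2 * T ^ 5 * (Real.sqrt (n * d n ^ 4) * (n * d n ^ 4))) atTop
        (𝓝 0) := by
      have := ((Real.continuous_sqrt.tendsto 0).comp hd4).mul hd4 |>.const_mul (2 * T ^ 5)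
      simpa using this
    refine squeeze_zero' (Eventually.of_forall fun n => ?_) ?_ hlim
    · have : 0 ≤ (n : ℝ) * (T * d n) ^ 5 := by
        have := hd0 n
        positivity
      exact mul_nonneg (Real.sqrt_nonneg _) (by linarith [Real.add_one_le_exp (n * (T * d n) ^ 5)])
    · filter_upwards [hd5.eventually (gt_mem_nhds zero_lt_one)] with n hn
      have h0 : 0 ≤ (n : ℝ) * (T * d n) ^ 5 := by
        have := hd0 n
        positivity
      have h1 : Real.exp (n * (T * d n) ^ 5) - 1 ≤ 2 * (n * (T * d n) ^ 5) := by
        have := Real.abs_exp_sub_one_le (x := n * (T * d n) ^ 5)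
          (by rw [abs_of_nonneg h0]; exact hn.le)
        rw [abs_of_nonneg h0] at this
        exact (le_abs_self _).trans this
      have h2 : Real.sqrt (n * d n ^ 4) = Real.sqrt n * d n ^ 2 := by
        rw [Real.sqrt_mul (Nat.cast_nonneg n), show d n ^ 4 = (d n ^ 2) ^ 2 by ring,
          Real.sqrt_sq (by positivity)]
      calc normA a n * (Real.exp (n * (T * d n) ^ 5) - 1)
          ≤ (Real.sqrt n * d n) * (2 * (n * (T * d n) ^ 5)) :=
            mul_le_mul (normA_le a n) h1
              (by linarith [Real.add_one_le_exp (n * (T * d n) ^ 5)])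
              (mul_nonneg (Real.sqrt_nonneg _) (hd0 n))
        _ = _ := by rw [h2]; ring
  · have : Tendsto (fun n => T * d n) atTop (𝓝 0) := by simpa using hdlim.const_mul T
    filter_upwards [this.eventually (ge_mem_nhds hδ₀)] with n hn t ht
    refine hF (T * d n) n t (mul_nonneg hT.le (hd0 n)) hn fun k hk => ?_
    rw [abs_mul]
    exact mul_le_mul ht (abs_le_maxCoeff a hk) (abs_nonneg _) hT.le

/-! ### Smoothing with the Fejér kernel -/

/-- The uniform probability measure on `(-r, r]`. -/
noncomputable def unif (r : ℝ) : Measure ℝ :=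
  ENNReal.ofReal (2 * r)⁻¹ • volume.restrict (Set.Ioc (-r) r)

theorem isProbabilityMeasure_unif {r : ℝ} (hr : 0 < r) : IsProbabilityMeasure (unif r) := by
  constructor
  rw [unif, Measure.smul_apply, Measure.restrict_apply_univ, Real.volume_Ioc, smul_eq_mul,
    ← ENNReal.ofReal_mul (by positivity), ← ENNReal.ofReal_one]
  congr 1
  field_simp
  ring

theorem integral_unif {E : Type*} [NormedAddCommGroup E] [NormedSpace ℝ E] {r : ℝ} (hr : 0 < r)
    (f : ℝ → E) : ∫ t, f t ∂unif r = (2 * r)⁻¹ • ∫ t in Set.Ioc (-r) r, f t := by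
  rw [unif, integral_smul_measure, ENNReal.toReal_ofReal (by positivity)]

theorem charFun_unif {r : ℝ} (hr : 0 < r) (x : ℝ) : charFun (unif r) x = Real.sinc (r * x) := by
  have h := integral_charFun_Icc (μ := Measure.dirac x) hr
  rw [integral_dirac, intervalIntegral.integral_of_le (by linarith)] at h
  rw [charFun_apply_real, integral_unif hr]
  have e : ∀ t : ℝ, Complex.exp (x * t * Complex.I) = charFun (Measure.dirac x) t := by
    intro t
    rw [charFun_apply_real, integral_dirac, mul_comm (x : ℂ)]
  simp_rw [e]
  rw [h, Complex.real_smul]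
  have : (r : ℂ) ≠ 0 := by exact_mod_cast hr.ne'
  push_cast
  field_simp

/-- Parseval's relation between the measure `P` and the weight `charFun ρ`. -/
theorem integral_charFun_add (P ρ : Measure ℝ) [IsFiniteMeasure P] [IsFiniteMeasure ρ] (s : ℝ) :
    ∫ u, charFun P (s + u) ∂ρ = ∫ x, Complex.exp (s * x * Complex.I) * charFun ρ x ∂P := by
  simp_rw [charFun_apply_real, ← integral_const_mul]
  rw [integral_integral_swap]
  · refine integral_congr_ae (ae_of_all _ fun x => integral_congr_ae (ae_of_all _ fun u => ?_))
    simp only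
    rw [← Complex.exp_add]
    congr 1
    push_cast
    ring
  · rw [← integrable_norm_iff (by fun_prop)]
    refine (integrable_const (1 : ℝ)).congr (ae_of_all _ fun p => ?_)
    simp only [Function.uncurry]
    rw [← Complex.ofReal_mul, Complex.norm_exp_ofReal_mul_I]

/-- The Fejér weight `(sin (r x) / (r x)) ^ 2`: a nonnegative integrable function whose Fourier
transform is supported in `[-2r, 2r]`. -/
noncomputable def fejer (r x : ℝ) : ℝ := Real.sinc (r * x) ^ 2

theorem fejer_nonneg (r x : ℝ) : 0 ≤ fejer r x := sq_nonneg _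

theorem fejer_le_one (r x : ℝ) : fejer r x ≤ 1 := by
  rw [fejer, sq_le_one_iff_abs_le_one]
  exact Real.abs_sinc_le_one _

theorem continuous_fejer (r : ℝ) : Continuous (fejer r) := by
  unfold fejer
  have := Real.continuous_sinc
  fun_prop

theorem integrable_fejer {r : ℝ} (hr : 0 < r) : Integrable (fejer r) := by
  have h1 : Integrable fun x : ℝ => 2 * (1 + (r * x) ^ 2)⁻¹ :=
    (integrable_inv_one_add_sq.comp_mul_left' hr.ne').const_mul 2
  refine h1.mono' (continuous_fejer r).aestronglyMeasurable (ae_of_all _ fun x => ?_)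
  rw [Real.norm_of_nonneg (fejer_nonneg r x), ← div_eq_mul_inv, le_div_iff₀ (by positivity)]
  have h2 : fejer r x * (r * x) ^ 2 ≤ 1 := by
    by_cases hx : r * x = 0
    · simp [hx]
    · rw [fejer, Real.sinc_of_ne_zero hx, ← mul_pow, div_mul_cancel₀ _ hx]
      exact Real.sin_sq_le_one _
  have := fejer_le_one r x
  linarith

theorem charFun_unif_conv_unif {r : ℝ} (hr : 0 < r) (x : ℝ) :
    charFun (unif r ∗ unif r) x = (fejer r x : ℝ) := by
  have := isProbabilityMeasure_unif hr
  rw [charFun_conv, charFun_unif hr, fejer]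
  push_cast
  ring

theorem integral_exp_neg_sq_shift_le {A r : ℝ} (hA : 0 < A) (s : ℝ) :
    ∫ w in Set.Ioc (-r) r, Real.exp (-((s + w) ^ 2 * A ^ 2 / 2)) ≤
      Real.sqrt (2 * Real.pi) / A := by
  have e : ∀ w : ℝ, Real.exp (-((s + w) ^ 2 * A ^ 2 / 2)) =
      (fun w => Real.exp (-(A ^ 2 / 2) * w ^ 2)) (w + s) := by
    intro w
    simp only
    congr 1
    ring
  have hint : Integrable fun w : ℝ => (fun w => Real.exp (-(A ^ 2 / 2) * w ^ 2)) (w + s) :=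
    (integrable_exp_neg_mul_sq (by positivity : 0 < A ^ 2 / 2)).comp_add_right s
  simp_rw [e]
  refine (setIntegral_le_integral hint (ae_of_all _ fun w => (Real.exp_pos _).le)).trans_eq ?_
  rw [integral_add_right_eq_self (fun w => Real.exp (-(A ^ 2 / 2) * w ^ 2)), integral_gaussian]
  rw [show Real.pi / (A ^ 2 / 2) = 2 * Real.pi / A ^ 2 by field_simp, Real.sqrt_div (by positivity),
    Real.sqrt_sq hA.le]

/-- After weighting by the Fejér kernel only the characteristic functions on a compact interval
matter, and a Gaussian bound on their difference gains a factor `1 / A` from integration. -/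
theorem norm_integral_fejer_sub_le (P Q : Measure ℝ) [IsProbabilityMeasure P]
    [IsProbabilityMeasure Q] {r A : ℝ} (hr : 0 < r) (hA : 0 < A) (s : ℝ) {η E : ℝ} (hη : 0 ≤ η)
    (h : ∀ t, |t| ≤ |s| + 2 * r →
      ‖charFun P t - charFun Q t‖ ≤ η * Real.exp (-(t ^ 2 * A ^ 2 / 2)) + E) :
    ‖∫ x, Complex.exp (s * x * Complex.I) * (fejer r x : ℝ) ∂P -
      ∫ x, Complex.exp (s * x * Complex.I) * (fejer r x : ℝ) ∂Q‖ ≤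
      η * (Real.sqrt (2 * Real.pi) / (2 * r * A)) + E := by
  have := isProbabilityMeasure_unif hr
  simp_rw [← charFun_unif_conv_unif hr]
  rw [← integral_charFun_add, ← integral_charFun_add]
  have hcont : ∀ (R : Measure ℝ) [IsProbabilityMeasure R], Measurable (charFun R) := fun R _ =>
    measurable_charFun
  have hintg : ∀ (R ρ : Measure ℝ) [IsProbabilityMeasure R] [IsProbabilityMeasure ρ] (c : ℝ),
      Integrable (fun u => charFun R (c + u)) ρ := by
    intro R ρ _ _ c
    refine (integrable_const (1 : ℝ)).mono' ?_ (ae_of_all _ fun u => norm_charFun_le_one _)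
    exact ((hcont R).comp (measurable_const_add c)).aestronglyMeasurable
  rw [← integral_sub (hintg P _ s) (hintg Q _ s),
    integral_conv (f := fun u => charFun P (s + u) - charFun Q (s + u))
      ((hintg P _ s).sub (hintg Q _ s))]
  have hae : ∀ᵐ u ∂unif r, u ∈ Set.Ioc (-r) r := by
    rw [unif]
    exact Measure.ae_smul_measure (ae_restrict_mem measurableSet_Ioc) _
  have hinner : ∀ᵐ u ∂unif r, ‖∫ w, (charFun P (s + (u + w)) - charFun Q (s + (u + w))) ∂unif r‖ ≤
      η * (Real.sqrt (2 * Real.pi) / (2 * r * A)) + E := by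
    filter_upwards [hae] with u hu
    have hG : Integrable (fun w => Real.exp (-((s + u + w) ^ 2 * A ^ 2 / 2))) (unif r) := by
      refine (integrable_const (1 : ℝ)).mono' (by fun_prop) (ae_of_all _ fun w => ?_)
      rw [Real.norm_of_nonneg (Real.exp_pos _).le, Real.exp_le_one_iff]
      have : 0 ≤ (s + u + w) ^ 2 * A ^ 2 / 2 := by positivity
      linarith
    refine (norm_integral_le_of_norm_le
      ((hG.const_mul η).add (integrable_const E)) ?_).trans ?_
    · filter_upwards [hae] with w hw
      have hb : |s + (u + w)| ≤ |s| + 2 * r := by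
        refine (abs_add_le _ _).trans ?_
        have h1 : |u| ≤ r := abs_le.mpr ⟨hu.1.le, hu.2⟩
        have h2 : |w| ≤ r := abs_le.mpr ⟨hw.1.le, hw.2⟩
        have h3 := abs_add_le u w
        linarith
      have := h _ hb
      rw [← add_assoc] at this ⊢
      exact this
    · simp only [Pi.add_apply]
      rw [integral_add (hG.const_mul η) (integrable_const E), integral_const_mul, integral_unif hr]
      simp only [integral_const, probReal_univ, smul_eq_mul, one_mul]
      gcongr
      calc _ ≤ (2 * r)⁻¹ * (Real.sqrt (2 * Real.pi) / A) := by
            gcongr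
            exact integral_exp_neg_sq_shift_le hA (s + u)
        _ = _ := by field_simp
  simpa using norm_integral_le_of_norm_le_const hinner

/-- Multiplied by their standard deviations, wide centred Gaussians converge to `(2π)^{-1/2}` times
Lebesgue measure. -/
theorem tendsto_integral_gaussian {A : ℕ → ℝ} (hA : Tendsto A atTop atTop) {f : ℝ → ℂ}
    (hf : Integrable f) :
    Tendsto (fun n => (A n : ℂ) * ∫ x, f x ∂ProbabilityTheory.gaussianReal 0 (A n ^ 2).toNNReal)
      atTop (𝓝 ((Real.sqrt (2 * Real.pi))⁻¹ * ∫ x, f x)) := by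
  have h1 : Tendsto (fun n => ∫ x, (Real.exp (-(x ^ 2 / (2 * A n ^ 2))) : ℂ) * f x) atTop
      (𝓝 (∫ x, f x)) := by
    refine tendsto_integral_of_dominated_convergence (fun x => ‖f x‖) (fun n => ?_) hf.norm
      (fun n => ae_of_all _ fun x => ?_) (ae_of_all _ fun x => ?_)
    · refine AEStronglyMeasurable.mul ?_ hf.aestronglyMeasurable
      apply Continuous.aestronglyMeasurable
      fun_prop
    · rw [norm_mul]
      refine mul_le_of_le_one_left (norm_nonneg _) ?_
      rw [Complex.norm_real, Real.norm_of_nonneg (Real.exp_pos _).le,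
        Real.exp_le_one_iff]
      have : 0 ≤ x ^ 2 / (2 * A n ^ 2) := by positivity
      linarith
    · have h2 : Tendsto (fun n => -(x ^ 2 / (2 * A n ^ 2))) atTop (𝓝 0) := by
        have : Tendsto (fun n => 2 * A n ^ 2) atTop atTop :=
          ((tendsto_pow_atTop two_ne_zero).comp hA).const_mul_atTop two_pos
        simpa using (this.const_div_atTop (x ^ 2)).neg
      have h3 := (Complex.continuous_ofReal.tendsto _).comp
        ((Real.continuous_exp.tendsto 0).comp h2)
      have h4 := h3.mul_const (f x)
      simpa [Function.comp_def] using h4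
  refine (h1.const_mul (((Real.sqrt (2 * Real.pi))⁻¹ : ℝ) : ℂ)).congr' ?_ |>.trans ?_
  · filter_upwards [hA.eventually_gt_atTop 0] with n hn
    have hv : (A n ^ 2).toNNReal ≠ 0 := by
      rw [Ne, Real.toNNReal_eq_zero, not_le]
      positivity
    rw [ProbabilityTheory.integral_gaussianReal_eq_integral_smul hv, ← integral_const_mul,
      ← integral_const_mul]
    refine integral_congr_ae (ae_of_all _ fun x => ?_)
    simp only [ProbabilityTheory.gaussianPDFReal_def, sub_zero, Real.coe_toNNReal _ (sq_nonneg _)]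
    have e : A n * (Real.sqrt (2 * Real.pi * A n ^ 2))⁻¹ = (Real.sqrt (2 * Real.pi))⁻¹ := by
      rw [Real.sqrt_mul (by positivity), Real.sqrt_sq hn.le, mul_inv, mul_comm, mul_assoc,
        inv_mul_cancel₀ hn.ne', mul_one]
    rw [Complex.real_smul, ← e, neg_div]
    push_cast
    ring
  · push_cast
    exact le_rfl

/-! ### From characteristic functions to a local limit theorem -/

/-- On each compact interval the characteristic function of `P n` is that of a centred Gaussian with
standard deviation `A n`, up to a relative error `o(1)` and an absolute error `o(1 / A n)`. -/
def HasGaussianCharFun (P : ℕ → Measure ℝ) (A : ℕ → ℝ) : Prop :=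
  ∀ T : ℝ, 0 < T → ∃ η E : ℕ → ℝ, Tendsto η atTop (𝓝 0) ∧
    Tendsto (fun n => A n * E n) atTop (𝓝 0) ∧
    ∀ᶠ n in atTop, ∀ t, |t| ≤ T →
      ‖charFun (P n) t - (Real.exp (-(t ^ 2 * A n ^ 2 / 2)) : ℝ)‖ ≤
        η n * Real.exp (-(t ^ 2 * A n ^ 2 / 2)) + E n

theorem tendsto_integral_fejer {P : ℕ → Measure ℝ} [∀ n, IsProbabilityMeasure (P n)]
    {A : ℕ → ℝ} (hA : Tendsto A atTop atTop) (h : HasGaussianCharFun P A) {r : ℝ} (hr : 0 < r)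
    (s : ℝ) :
    Tendsto (fun n => (A n : ℂ) *
      ∫ x, Complex.exp (s * x * Complex.I) * (fejer r x : ℝ) ∂P n) atTop
      (𝓝 ((Real.sqrt (2 * Real.pi))⁻¹ *
        ∫ x : ℝ, Complex.exp (s * x * Complex.I) * (fejer r x : ℝ))) := by
  have hint : Integrable fun x : ℝ => Complex.exp (s * x * Complex.I) * (fejer r x : ℝ) := by
    refine (integrable_fejer hr).mono' ?_ (ae_of_all _ fun x => ?_)
    · have := continuous_fejer r
      apply Continuous.aestronglyMeasurable
      fun_prop
    · rw [← Complex.ofReal_mul, norm_mul, Complex.norm_exp_ofReal_mul_I, one_mul,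
        Complex.norm_real, Real.norm_of_nonneg (fejer_nonneg r x)]
  have hG := tendsto_integral_gaussian hA hint
  obtain ⟨η, E, hη, hE, hbound⟩ := h (|s| + 2 * r) (by positivity)
  refine (tendsto_iff_of_dist ?_).mpr hG
  have hlim : Tendsto (fun n => |η n| * (Real.sqrt (2 * Real.pi) / (2 * r)) + A n * E n) atTop
      (𝓝 0) := by
    have := (hη.abs.mul_const (Real.sqrt (2 * Real.pi) / (2 * r))).add hE
    simpa using this
  refine squeeze_zero' (Eventually.of_forall fun n => dist_nonneg) ?_ hlim
  filter_upwards [hbound, hA.eventually_gt_atTop 0] with n hn hAn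
  have hb := norm_integral_fejer_sub_le (P n)
    (ProbabilityTheory.gaussianReal 0 (A n ^ 2).toNNReal) hr hAn s (abs_nonneg (η n)) (E := E n)
    (fun t ht => ?_)
  · rw [dist_eq_norm, ← mul_sub, norm_mul, Complex.norm_real, Real.norm_of_nonneg hAn.le]
    refine (mul_le_mul_of_nonneg_left hb hAn.le).trans_eq ?_
    field_simp
  · have e : charFun (ProbabilityTheory.gaussianReal 0 (A n ^ 2).toNNReal) t =
        (Real.exp (-(t ^ 2 * A n ^ 2 / 2)) : ℝ) := by
      rw [ProbabilityTheory.charFun_gaussianReal, Real.coe_toNNReal _ (sq_nonneg _)]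
      push_cast
      congr 1
      ring
    rw [e]
    refine (hn t ht).trans ?_
    gcongr
    exact le_abs_self _

/-- The measure with density `w` with respect to `P`, normalised to a probability measure. Where the
total mass vanishes, the measure is arbitrary. -/
theorem exists_probabilityMeasure_weighted (P : Measure ℝ) {w : ℝ → ℝ} (hw : Continuous w)
    (hw0 : ∀ x, 0 ≤ w x) (hint : Integrable w P) :
    ∃ μ : ProbabilityMeasure ℝ, 0 < ∫ x, w x ∂P →
      ∀ (E : Type) [NormedAddCommGroup E] [NormedSpace ℝ E] (f : ℝ → E),
        ∫ x, f x ∂(μ : Measure ℝ) = (∫ x, w x ∂P)⁻¹ • ∫ x, w x • f x ∂P := by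
  by_cases hZ : 0 < ∫ x, w x ∂P
  swap
  · exact ⟨⟨Measure.dirac 0, inferInstance⟩, fun h => absurd h hZ⟩
  set Z := ∫ x, w x ∂P
  have hmeas : Measurable fun x => ENNReal.ofReal (Z⁻¹ * w x) := by fun_prop
  refine ⟨⟨P.withDensity fun x => ENNReal.ofReal (Z⁻¹ * w x), ⟨?_⟩⟩, fun _ E _ _ f => ?_⟩
  · rw [withDensity_apply _ MeasurableSet.univ, Measure.restrict_univ,
      ← ofReal_integral_eq_lintegral_ofReal (hint.const_mul _)
        (ae_of_all _ fun x => mul_nonneg (inv_nonneg.mpr hZ.le) (hw0 x)), integral_const_mul,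
      inv_mul_cancel₀ hZ.ne', ENNReal.ofReal_one]
  · simp only [ProbabilityMeasure.coe_mk]
    rw [integral_withDensity_eq_integral_toReal_smul hmeas
        (ae_of_all _ fun x => ENNReal.ofReal_lt_top),
      ← integral_smul]
    refine integral_congr_ae (ae_of_all _ fun x => ?_)
    simp only
    rw [ENNReal.toReal_ofReal (mul_nonneg (inv_nonneg.mpr hZ.le) (hw0 x)), mul_smul]

theorem integral_fejer_pos {r : ℝ} (hr : 0 < r) : 0 < ∫ x, fejer r x := by
  exact integral_pos_of_integrable_nonneg_nonzero (x := 0) (continuous_fejer r)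
    (integrable_fejer hr) (fejer_nonneg r) (by simp [fejer])

/-- Lévy's continuity theorem, applied to the normalised measures with density `fejer r`. -/
theorem tendsto_integral_fejer_mul {P : ℕ → Measure ℝ} [∀ n, IsProbabilityMeasure (P n)]
    {A : ℕ → ℝ} (hA : Tendsto A atTop atTop) (h : HasGaussianCharFun P A) {r : ℝ} (hr : 0 < r)
    (f : BoundedContinuousFunction ℝ ℝ) :
    Tendsto (fun n => A n * ∫ x, fejer r x * f x ∂P n) atTop
      (𝓝 ((Real.sqrt (2 * Real.pi))⁻¹ * ∫ x, fejer r x * f x)) := by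
  have hintP : ∀ n, Integrable (fejer r) (P n) := fun n =>
    (integrable_const (1 : ℝ)).mono' (continuous_fejer r).aestronglyMeasurable
      (ae_of_all _ fun x => by
        rw [Real.norm_of_nonneg (fejer_nonneg r x)]; exact fejer_le_one r x)
  set c := (Real.sqrt (2 * Real.pi))⁻¹ with hc
  have hc0 : 0 < c := by positivity
  set Z := ∫ x, fejer r x
  have hZ : 0 < Z := integral_fejer_pos hr
  have hZlim : Tendsto (fun n => A n * ∫ x, fejer r x ∂P n) atTop (𝓝 (c * Z)) := by
    have h1 := tendsto_integral_fejer hA h hr 0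
    rw [← hc] at h1
    simp only [Complex.ofReal_zero, zero_mul, Complex.exp_zero, one_mul, integral_complex_ofReal,
      ← Complex.ofReal_mul] at h1
    have h2 := (Complex.continuous_re.tendsto _).comp h1
    simpa [Function.comp_def] using h2
  have hZpos : ∀ᶠ n in atTop, 0 < ∫ x, fejer r x ∂P n := by
    filter_upwards [hZlim.eventually (lt_mem_nhds (mul_pos hc0 hZ)), hA.eventually_gt_atTop 0]
      with n hn hAn
    exact (pos_iff_pos_of_mul_pos hn).mp hAn
  choose μ hμ using fun n => exists_probabilityMeasure_weighted (P n) (continuous_fejer r)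
    (fejer_nonneg r) (hintP n)
  obtain ⟨ν, hν⟩ := exists_probabilityMeasure_weighted volume (continuous_fejer r)
    (fejer_nonneg r) (integrable_fejer hr)
  have hν := hν hZ
  have hlim : Tendsto μ atTop (𝓝 ν) := by
    refine ProbabilityMeasure.tendsto_of_tendsto_charFun fun s => ?_
    rw [charFun_apply_real, hν]
    have h1 := (tendsto_integral_fejer hA h hr s).div
      ((Complex.continuous_ofReal.tendsto _).comp hZlim)
      (by exact_mod_cast (mul_pos hc0 hZ).ne')
    have e1 : (c : ℂ) * (∫ x : ℝ, Complex.exp (s * x * Complex.I) * (fejer r x : ℝ)) / (c * Z : ℝ) =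
        Z⁻¹ • ∫ x : ℝ, fejer r x • Complex.exp (s * x * Complex.I) := by
      have : (c : ℂ) ≠ 0 := by exact_mod_cast hc0.ne'
      simp only [Complex.real_smul]
      push_cast
      rw [mul_div_mul_left _ _ this, div_eq_inv_mul]
      simp_rw [mul_comm]
    rw [← hc, e1] at h1
    refine h1.congr' ?_
    filter_upwards [hZpos, hA.eventually_gt_atTop 0] with n hn hAn
    rw [charFun_apply_real, hμ n hn]
    have : (A n : ℂ) ≠ 0 := by exact_mod_cast hAn.ne'
    simp only [Complex.real_smul, Pi.div_apply, Function.comp_apply]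
    push_cast
    rw [mul_div_mul_left _ _ this, div_eq_inv_mul]
    simp_rw [mul_comm]
  have h2 := (ProbabilityMeasure.tendsto_iff_forall_integral_tendsto.mp hlim) f
  rw [hν] at h2
  have h3 := hZlim.mul h2
  rw [smul_eq_mul, mul_assoc, mul_inv_cancel_left₀ hZ.ne'] at h3
  refine h3.congr' ?_
  filter_upwards [hZpos] with n hn
  rw [hμ n hn, smul_eq_mul, mul_assoc, mul_inv_cancel_left₀ hn.ne']
  rfl

/-- The Fejér weight is removed by dividing the test function by it, on an interval where the weight
is bounded below. -/
theorem tendsto_integral_of_hasCompactSupport {P : ℕ → Measure ℝ}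
    [∀ n, IsProbabilityMeasure (P n)] {A : ℕ → ℝ} (hA : Tendsto A atTop atTop)
    (h : HasGaussianCharFun P A) (g : C(ℝ, ℝ)) (hg : HasCompactSupport g) :
    Tendsto (fun n => A n * ∫ x, g x ∂P n) atTop
      (𝓝 ((Real.sqrt (2 * Real.pi))⁻¹ * ∫ x, g x)) := by
  obtain ⟨R, hR⟩ := hg.isCompact.isBounded.subset_closedBall (0 : ℝ)
  set R' := max R 1 with hR'
  have hR'0 : 0 < R' := lt_of_lt_of_le one_pos (le_max_right _ _)
  have hr : 0 < R'⁻¹ := inv_pos.mpr hR'0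
  have hsupp : ∀ x, g x ≠ 0 → |x| ≤ R' := by
    intro x hx
    have := hR (subset_tsupport g hx)
    rw [mem_closedBall_zero_iff, Real.norm_eq_abs] at this
    exact this.trans (le_max_left _ _)
  have hlow : ∀ x, |x| ≤ R' → (1 / 4 : ℝ) ≤ fejer R'⁻¹ x := by
    intro x hx
    have h1 : |R'⁻¹ * x| ≤ 1 := by
      rw [abs_mul, abs_of_pos hr, inv_mul_le_iff₀ hR'0, mul_one]
      exact hx
    rw [fejer]
    set y := R'⁻¹ * x
    rw [← sq_abs]
    have key : (1 / 2 : ℝ) ≤ |Real.sinc y| := by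
      by_cases hy : y = 0
      · rw [hy]; norm_num
      rw [Real.sinc_of_ne_zero hy, abs_div, le_div_iff₀ (abs_pos.mpr hy)]
      have h2 : |Real.sin y| = Real.sin |y| := by
        rw [← Real.abs_sin_eq_sin_abs_of_abs_le_pi (by linarith [Real.pi_gt_three])]
      rw [h2]
      have h3 := Real.mul_le_sin (abs_nonneg y) (by linarith [Real.pi_gt_three])
      refine le_trans ?_ h3
      refine mul_le_mul_of_nonneg_right ?_ (abs_nonneg y)
      rw [div_le_div_iff₀ two_pos Real.pi_pos]
      linarith [Real.pi_le_four]
    nlinarith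
  -- the maximum only serves to make the quotient continuous outside the support of `g`
  set f : ℝ → ℝ := fun x => g x / max (fejer R'⁻¹ x) (1 / 4)
  have hden : ∀ x, 0 < max (fejer R'⁻¹ x) (1 / 4) := fun x =>
    lt_of_lt_of_le (by norm_num) (le_max_right _ _)
  have hfc : Continuous f :=
    g.continuous.div ((continuous_fejer _).max continuous_const) fun x => (hden x).ne'
  have hfsupp : HasCompactSupport f := by
    refine hg.mono fun x hx => ?_
    rw [Function.mem_support] at hx ⊢
    intro h0
    exact hx (by simp [f, h0])
  obtain ⟨C, hC⟩ := hfsupp.exists_bound_of_continuous hfc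
  have hmul : ∀ x, fejer R'⁻¹ x * f x = g x := by
    intro x
    by_cases hx : g x = 0
    · simp [f, hx]
    · have := hlow x (hsupp x hx)
      simp only [f]
      rw [max_eq_left this, mul_div_cancel₀]
      linarith
  have := tendsto_integral_fejer_mul hA h hr
    (BoundedContinuousFunction.ofNormedAddCommGroup f hfc C hC)
  simpa [hmul] using this

/-- The indicator of `B` is squeezed between continuous functions of compact support. The sequence
`p` stands for the measure of `B` itself, which need not be a Borel set. -/
theorem tendsto_mul_measure_of_jordan {P : ℕ → Measure ℝ} [∀ n, IsProbabilityMeasure (P n)]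
    {A : ℕ → ℝ} (hA : Tendsto A atTop atTop) (h : HasGaussianCharFun P A) {B : Set ℝ}
    (hB : IsBoundedJordanMeasurable B) {p : ℕ → ℝ} (hpl : ∀ n, (P n).real (interior B) ≤ p n)
    (hpu : ∀ n, p n ≤ (P n).real (closure B)) :
    Tendsto (fun n => A n * p n) atTop
      (𝓝 ((Real.sqrt (2 * Real.pi))⁻¹ * volume.real B)) := by
  obtain ⟨hbd, hfr⟩ := hB
  set c := (Real.sqrt (2 * Real.pi))⁻¹
  have hc0 : 0 < c := by positivity
  have hK : IsCompact (closure B) := hbd.isCompact_closure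
  have hcl : volume (closure B) = volume B := by
    refine le_antisymm ?_ (measure_mono subset_closure)
    rw [← Set.union_sdiff_cancel (subset_closure : B ⊆ closure B)]
    refine (measure_union_le _ _).trans ?_
    rw [measure_mono_null (Set.sdiff_subset_sdiff_right interior_subset) hfr, add_zero]
  have hin : volume (interior B) = volume B := by
    refine le_antisymm (measure_mono interior_subset) ?_
    rw [← hcl, ← Set.union_sdiff_cancel (interior_subset_closure : interior B ⊆ closure B)]
    refine (measure_union_le _ _).trans ?_
    rw [show volume (closure B \ interior B) = 0 from hfr, add_zero]
  have hfin : volume B ≠ ⊤ := by rw [← hcl]; exact hK.measure_lt_top.ne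
  have hintg : ∀ (g : C(ℝ, ℝ)), HasCompactSupport g → ∀ (μ : Measure ℝ)
      [IsFiniteMeasureOnCompacts μ], Integrable g μ := fun g hg μ _ =>
    g.continuous.integrable_of_hasCompactSupport hg
  have hApos := hA.eventually_gt_atTop 0
  rw [tendsto_order]
  constructor
  · intro b hb
    rcases lt_or_ge b 0 with hb0 | hb0
    · filter_upwards [hApos] with n hn
      exact hb0.trans_le (mul_nonneg hn.le (measureReal_nonneg.trans (hpl n)))
    have hbc : ENNReal.ofReal (b / c) < volume (interior B) := by
      rw [hin, ENNReal.ofReal_lt_iff_lt_toReal (by positivity) hfin, div_lt_iff₀ hc0, mul_comm]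
      exact hb
    obtain ⟨K, hKB, hKc, hKvol⟩ := isOpen_interior.exists_lt_isCompact hbc
    obtain ⟨g, hg1, hg0, hgs, hg01⟩ := exists_continuous_one_zero_of_isCompact hKc
      isOpen_interior.isClosed_compl (Set.disjoint_compl_right_iff_subset.mpr hKB)
    have hlim := tendsto_integral_of_hasCompactSupport hA h g hgs
    have hlt : b < c * ∫ x, g x := by
      have h1 : volume.real K ≤ ∫ x, g x := by
        rw [← integral_indicator_one hKc.measurableSet]
        refine integral_mono ((integrable_indicator_iff hKc.measurableSet).mpr
          (integrableOn_const hKc.measure_lt_top.ne)) (hintg g hgs _) fun x => ?_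
        by_cases hx : x ∈ K
        · simp [hx, hg1 hx]
        · simp [hx, (hg01 x).1]
      have h2 : b / c < volume.real K := by
        rw [ENNReal.ofReal_lt_iff_lt_toReal (by positivity) hKc.measure_lt_top.ne] at hKvol
        exact hKvol
      rw [div_lt_iff₀ hc0] at h2
      nlinarith
    filter_upwards [hlim.eventually (lt_mem_nhds hlt), hApos] with n hn hAn
    refine hn.trans_le (mul_le_mul_of_nonneg_left ?_ hAn.le)
    refine le_trans ?_ (hpl n)
    rw [← integral_indicator_one isOpen_interior.measurableSet]
    refine integral_mono (hintg g hgs _) ((integrable_indicator_iff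
      isOpen_interior.measurableSet).mpr (integrableOn_const (measure_ne_top _ _))) fun x => ?_
    by_cases hx : x ∈ interior B
    · simp [hx, (hg01 x).2]
    · simp [hx, hg0 hx]
  · intro b hb
    have hbc : volume (closure B) < ENNReal.ofReal (b / c) := by
      rw [hcl, ENNReal.lt_ofReal_iff_toReal_lt hfin, lt_div_iff₀ hc0, mul_comm]
      exact hb
    obtain ⟨U, hBU, hU, hUvol⟩ := (closure B).exists_isOpen_lt_of_lt _ hbc
    obtain ⟨g, hg1, hg0, hgs, hg01⟩ := exists_continuous_one_zero_of_isCompact hK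
      hU.isClosed_compl (Set.disjoint_compl_right_iff_subset.mpr hBU)
    have hlim := tendsto_integral_of_hasCompactSupport hA h g hgs
    have hUfin : volume U ≠ ⊤ := (hUvol.trans ENNReal.ofReal_lt_top).ne
    have hlt : c * ∫ x, g x < b := by
      have h1 : ∫ x, g x ≤ volume.real U := by
        rw [← integral_indicator_one hU.measurableSet]
        refine integral_mono (hintg g hgs _) ((integrable_indicator_iff
          hU.measurableSet).mpr (integrableOn_const hUfin)) fun x => ?_
        by_cases hx : x ∈ U
        · simp [hx, (hg01 x).2]
        · simp [hx, hg0 hx]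
      have h2 : volume.real U < b / c := by
        rw [ENNReal.lt_ofReal_iff_toReal_lt hUfin] at hUvol
        exact hUvol
      rw [lt_div_iff₀ hc0] at h2
      nlinarith
    filter_upwards [hlim.eventually (gt_mem_nhds hlt), hApos] with n hn hAn
    refine lt_of_le_of_lt (mul_le_mul_of_nonneg_left ?_ hAn.le) hn
    refine (hpu n).trans ?_
    rw [← integral_indicator_one hK.measurableSet]
    refine integral_mono ((integrable_indicator_iff hK.measurableSet).mpr
      (integrableOn_const (measure_ne_top _ _))) (hintg g hgs _) fun x => ?_
    by_cases hx : x ∈ closure B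
    · simp [hx, hg1 hx]
    · simp [hx, (hg01 x).1]

/-! ### The law of the lacunary sum -/

theorem continuous_partialSum (a : ℕ → ℕ → ℝ) (m : ℕ → ℤ) (n : ℕ) :
    Continuous (partialSum a m n) := by
  unfold partialSum
  fun_prop

/-- The distribution of `S_n` with respect to Lebesgue measure on `[0, 1]`. -/
noncomputable def law (a : ℕ → ℕ → ℝ) (m : ℕ → ℤ) (n : ℕ) : Measure ℝ :=
  (volume.restrict (Set.Icc (0 : ℝ) 1)).map (partialSum a m n)

instance isProbabilityMeasure_law (a : ℕ → ℕ → ℝ) (m : ℕ → ℤ) (n : ℕ) :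
    IsProbabilityMeasure (law a m n) := by
  have : IsProbabilityMeasure (volume.restrict (Set.Icc (0 : ℝ) 1)) := ⟨by simp⟩
  exact Measure.isProbabilityMeasure_map (continuous_partialSum a m n).aemeasurable

theorem charFun_law (a : ℕ → ℕ → ℝ) (m : ℕ → ℤ) (n : ℕ) (t : ℝ) :
    charFun (law a m n) t = sumCharFun a m n t := by
  rw [charFun_apply_real, law, integral_map (continuous_partialSum a m n).aemeasurable
    (by fun_prop), sumCharFun, intervalIntegral.integral_of_le zero_le_one,
    integral_Icc_eq_integral_Ioc]
  refine integral_congr_ae (ae_of_all _ fun x => ?_)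
  simp only
  congr 1
  push_cast
  ring

theorem law_real_apply (a : ℕ → ℕ → ℝ) (m : ℕ → ℤ) (n : ℕ) {B : Set ℝ} (hB : MeasurableSet B) :
    (law a m n).real B =
      volume.real {x : ℝ | x ∈ Set.Icc (0 : ℝ) 1 ∧ partialSum a m n x ∈ B} := by
  have hm := (continuous_partialSum a m n).measurable
  rw [measureReal_def, law, Measure.map_apply hm hB, Measure.restrict_apply (hm hB),
    measureReal_def]
  congr 2
  ext x
  exact and_comm

end LacunaryTrig

theorem mainTheorem2 (a : ℕ → ℕ → ℝ) (m : ℕ → ℤ) (q ε : ℝ)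
    (hm : LacunaryTrig.IsLacunary m q)
    (hA : Tendsto (fun n : ℕ => LacunaryTrig.normA a n) atTop atTop)
    (hε : 0 < ε)
    (hd_small : q ≤ 2 →
      Tendsto (fun n : ℕ => (n : ℝ) ^ (1 + ε) * LacunaryTrig.maxCoeff a n ^ 3) atTop (𝓝 0))
    (hd_large : 2 < q →
      Tendsto (fun n : ℕ => (n : ℝ) ^ (1 + ε) * LacunaryTrig.maxCoeff a n ^ 4) atTop (𝓝 0))
    (B : Set ℝ) (hB : LacunaryTrig.IsBoundedJordanMeasurable B) :
    Tendsto
      (fun n : ℕ => LacunaryTrig.normA a n *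
        volume.real {x : ℝ | x ∈ Set.Icc (0 : ℝ) 1 ∧ LacunaryTrig.partialSum a m n x ∈ B})
      atTop (𝓝 (1 / Real.sqrt (2 * Real.pi) * volume.real B)) := by
  open LacunaryTrig in
  have hq := hm.one_lt
  -- relations of three terms such as `2 m_k = m_{k+1}` are possible only when `q ≤ 2`
  obtain ⟨r, hr2, hr4, hrq, hd⟩ : ∃ r : ℕ, 2 ≤ r ∧ r ≤ 4 ∧ (r : ℝ) - 2 < q ∧
      Tendsto (fun n : ℕ => (n : ℝ) * maxCoeff a n ^ r) atTop (𝓝 0) := by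
    rcases le_or_gt q 2 with h2 | h2
    · exact ⟨3, by norm_num, by norm_num, by norm_num; linarith,
        tendsto_nat_mul_pow_of_rpow (maxCoeff_nonneg a) hε (hd_small h2)⟩
    · exact ⟨4, by norm_num, by norm_num, by norm_num; linarith,
        tendsto_nat_mul_pow_of_rpow (maxCoeff_nonneg a) hε (hd_large h2)⟩
  have hchar : HasGaussianCharFun (law a m) (normA a) := by
    intro T hT
    simp_rw [charFun_law]
    exact hm.exists_sumCharFun_approx hr2 hr4 hrq a hd hT
  have hfinite : ∀ n (D : Set ℝ),
      volume {x : ℝ | x ∈ Set.Icc (0 : ℝ) 1 ∧ partialSum a m n x ∈ D} ≠ ⊤ := fun n D =>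
    ((measure_mono fun x hx => hx.1).trans_lt
      (isCompact_Icc.measure_lt_top (μ := volume) (K := Set.Icc (0 : ℝ) 1))).ne
  rw [one_div]
  refine tendsto_mul_measure_of_jordan hA hchar hB (fun n => ?_) (fun n => ?_)
  · rw [law_real_apply a m n isOpen_interior.measurableSet]
    exact measureReal_mono (fun x hx => ⟨hx.1, interior_subset hx.2⟩) (hfinite n _)
  · rw [law_real_apply a m n isClosed_closure.measurableSet]
    exact measureReal_mono (fun x hx => ⟨hx.1, subset_closure hx.2⟩) (hfinite n _)
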